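/- Let $n,d\ge 1$ be integers. Let $P_{n,d}$ be the set of real-valued $(d,d)$-bihomogeneous polynomials $A(z,\bar z)=\sum_{|\alpha|=|\beta|=d}H_{\alpha\beta}z^\alpha\bar z^\beta$ on $\mathbb C^n$. The matrix of $A$ is $(H_{\alpha\beta})$, and its rank is the rank of $A$. Let $\Sigma_{n,d}$ be the set of those $A\in P_{n,d}$ with $A(z,\bar z)=\|h(z)\|^2$ for some holomorphic polynomial map $h=(h_1,\dots,h_R)$. Let $\mathcal C_{n,d}$ be the set of all $A\in P_{n,d}$ whose matrix is diagonal and for which $A\notin\Sigma_{n,d}$ while $A\|z\|^2\in\Sigma_{n,d+1}$, where $\|z\|$ is the Euclidean norm. For $n\ge1$ put $E(n)=(\kappa_0+1)n-\frac{\kappa_0(\kappa_0+1)}2-1$ (Ebenfelt's conjectured bound), where $\kappa_0=\kappa_0(n)$ is the largest integer $\kappa$ with $\kappa(\kappa+1)/2<n$. (A) For all $n,d\ge2$ and all $A\in\mathcal C_{n,d}$, the rank $R$ of $A\|z\|^2$ satisfies $R\ge 3n-4$. For $2\le n\le 6$ one has $3n-4\ge E(n)$, with equality if and only if $n\ne3$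 (for $n=3$, $3n-4=5>4=E(3)$). For $2\le n\le4$ the bound is sharp: for every $d\ge2$ there is $A\in\mathcal C_{n,d}$ such that $A\|z\|^2$ has rank exactly $3n-4$. (B) For all $n\ge6$ and all $A\in\mathcal C_{n,2}$, the rank $R$ of $A\|z\|^2$ satisfies $R\ge\frac{n^2+n}2-6$. As $n\to\infty$ this lower bound has order of magnitude exactly $n^2$, while $E(n)$ has order of magnitude exactly $n^{3/2}$ (that is, $\frac{n^2+n}2-6=\Theta(n^2)$ and $E(n)=\Theta(n^{3/2})$). Equivalent formulation. Let $J_{n,d}$ be the matrix, in the bases of monomials, of the linear map $A(x)\mapsto A(x)(x_1+\dots+x_n)$ from real forms of degree $d$ to real forms of degree $d+1$ in $x_1,\dots,x_n$, and let $R(v)$ be the number of nonzero components of a real vector $v$. For all $n,d\ge2$, $$\{R(J_{n,d}h): h\in\mathbb R^{\binom{n+d-1}{d}},\ h\not\ge0,\ J_{n,d}h\ge0\}=\{\operatorname{rank}(A\|z\|^2): A\in\mathcal C_{n,d}\},$$ where vector inequalities are componentwise. This set is non-empty, and its minimum $R_{n,d}$ satisfies $R_{n,d}\ge 3n-4$;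 moreover $R_{n,2}\ge\frac{n^2+n}2-6$ for $n\ge6$. -/

import Mathlib

noncomputable section

namespace HermSOS

/-- Multi-indices `α ∈ ℕⁿ` with `|α| = d`; they index the monomials `z^α` of degree `d`. -/
abbrev MultiIdx (n d : ℕ) : Type :=
  {α : Fin n →₀ ℕ // α ∈ Finset.finsuppAntidiag (Finset.univ : Finset (Fin n)) d}

/-- Polynomials in `z₁, …, zₙ, z̄₁, …, z̄ₙ` with complex coefficients: the variable `Sum.inl i`
stands for `zᵢ` and the variable `Sum.inr i` for `z̄ᵢ`. -/
abbrev MixedPoly (n : ℕ) : Type := MvPolynomial (Fin n ⊕ Fin n) ℂ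

/-- The value `A(z, z̄)`. -/
def value {n : ℕ} (A : MixedPoly n) (z : Fin n → ℂ) : ℂ :=
  MvPolynomial.eval (Sum.elim z fun i => (starRingEnd ℂ) (z i)) A

/-- `A(z, z̄)` is real for every `z ∈ ℂⁿ`. -/
def IsRealValued {n : ℕ} (A : MixedPoly n) : Prop :=
  ∀ z : Fin n → ℂ, (value A z).im = 0

/-- Every monomial of `A` has degree `d` in `z` and degree `d` in `z̄`. -/
def IsBihomogeneous {n : ℕ} (d : ℕ) (A : MixedPoly n) : Prop :=
  ∀ m ∈ A.support, (∑ i, m (Sum.inl i)) = d ∧ (∑ i, m (Sum.inr i)) = d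

/-- `P_{n,d}`: the real-valued `(d,d)`-bihomogeneous Hermitian polynomials. -/
def forms (n d : ℕ) : Set (MixedPoly n) :=
  {A | IsRealValued A ∧ IsBihomogeneous d A}

/-- `SOS_n`: `A(z, z̄) = ‖h(z)‖²` for some holomorphic polynomial map `h = (h₁, …, h_R)`. -/
def sos (n : ℕ) : Set (MixedPoly n) :=
  {A | ∃ (R : ℕ) (h : Fin R → MvPolynomial (Fin n) ℂ), ∀ z : Fin n → ℂ,
    value A z = ((∑ k, ‖MvPolynomial.eval z (h k)‖ ^ 2 : ℝ) : ℂ)}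

/-- `Σ_{n,d} = SOS_n ∩ P_{n,d}`. -/
def sosForms (n d : ℕ) : Set (MixedPoly n) := sos n ∩ forms n d

/-- `‖z‖² = z₁ z̄₁ + ⋯ + zₙ z̄ₙ`. -/
def normSq (n : ℕ) : MixedPoly n :=
  ∑ i, MvPolynomial.X (Sum.inl i) * MvPolynomial.X (Sum.inr i)

/-- The matrix `H` of a `(d,d)`-bihomogeneous polynomial `A = ∑ H α β z^α z̄^β`
in the basis of monomials of degree `d`. -/
def coeffMatrix {n : ℕ} (d : ℕ) (A : MixedPoly n) : Matrix (MultiIdx n d) (MultiIdx n d) ℂ :=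
  Matrix.of fun α β => MvPolynomial.coeff (Finsupp.sumElim α.1 β.1) A

/-- The rank of a `(d,d)`-bihomogeneous polynomial: the rank of its matrix. -/
def formRank {n : ℕ} (d : ℕ) (A : MixedPoly n) : ℕ := (coeffMatrix d A).rank

/-- The real-valued `(d,d)`-bihomogeneous `A` with diagonal matrix such that `A` is not a sum of
squares while `A ‖z‖²` is one. -/
def criticalForms (n d : ℕ) : Set (MixedPoly n) :=
  {A | A ∈ forms n d ∧ (coeffMatrix d A).IsDiag ∧
    A ∉ sosForms n d ∧ A * normSq n ∈ sosForms n (d + 1)}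

/-- The prolongation matrix `J_{n,d}`: the matrix, in the bases of monomials, of the linear map
`A(x) ↦ A(x) (x₁ + ⋯ + xₙ)` from real forms of degree `d` to real forms of degree `d + 1`. -/
def prolongation (n d : ℕ) : Matrix (MultiIdx n (d + 1)) (MultiIdx n d) ℝ :=
  Matrix.of fun β α => MvPolynomial.coeff β.1
    (MvPolynomial.monomial α.1 (1 : ℝ) * ∑ i, MvPolynomial.X i)

/-- The rank of a real vector: the number of its nonzero components. -/
def vecRank {ι : Type} (v : ι → ℝ) : ℕ := {i | v i ≠ 0}.ncard

/-- The ranks `R(J_{n,d} h)` for `h ≱ 0` with `J_{n,d} h ≥ 0` (componentwise). -/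
def prolongedRanks (n d : ℕ) : Set ℕ :=
  {r | ∃ h : MultiIdx n d → ℝ, ¬ 0 ≤ h ∧ 0 ≤ (prolongation n d).mulVec h ∧
    r = vecRank ((prolongation n d).mulVec h)}

/-- `R_{n,d}`, the minimum of these ranks. -/
def minRank (n d : ℕ) : ℕ := sInf (prolongedRanks n d)

/-- `κ₀`: the largest integer `κ` such that `κ (κ + 1) / 2 < n`. -/
def kappa (n : ℕ) : ℕ := Nat.findGreatest (fun k => k * (k + 1) < 2 * n) n

theorem kappa_isGreatest {n : ℕ} (hn : 1 ≤ n) :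
    IsGreatest {k : ℕ | (k : ℝ) * (k + 1) / 2 < n} (kappa n) := by
  have key : ∀ k : ℕ, (k : ℝ) * (k + 1) / 2 < n ↔ k * (k + 1) < 2 * n := by
    intro k
    rw [div_lt_iff₀ (by norm_num)]
    constructor
    · intro h
      have h' : ((k * (k + 1) : ℕ) : ℝ) < ((2 * n : ℕ) : ℝ) := by push_cast; linarith
      exact_mod_cast h'
    · intro h
      have h' : ((k * (k + 1) : ℕ) : ℝ) < ((2 * n : ℕ) : ℝ) := by exact_mod_cast h
      push_cast at h'
      linarith
  constructor
  · rw [Set.mem_ofPred_eq, key]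
    exact Nat.findGreatest_spec (P := fun k => k * (k + 1) < 2 * n) (Nat.zero_le n) (by omega)
  · intro k hk
    rw [Set.mem_ofPred_eq, key] at hk
    refine Nat.le_findGreatest ?_ hk
    by_contra! hlt
    nlinarith

/-- Ebenfelt's bound `(κ₀ + 1) n - κ₀ (κ₀ + 1) / 2 - 1`. -/
def ebenfeltBound (n : ℕ) : ℝ :=
  ((kappa n : ℝ) + 1) * n - (kappa n : ℝ) * ((kappa n : ℝ) + 1) / 2 - 1

end HermSOS

end

/-! Putting `x i = |z i|²` turns a form with diagonal matrix into a real form `h` in `x`. It is a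
sum of squares exactly when no coefficient of `h` is negative, and its rank is the number of terms
of `h`. Multiplication by `‖z‖²` becomes multiplication by the sum of the variables. So the task is
to count the terms of `g = (∑ x i) * h` when `h` has a negative coefficient and `g` has none
(`IsCritical`).

The bound `3m - 4`, with `m` the number of variables, is proved by induction on `m`, then on the
degree (`three_mul_card_le`). A variable dividing `h` is cancelled. Otherwise, if `h` is nonnegative
on every facet `x k = 0`, a monomial on a facet creates `m - 1` terms of `g`; either three such
families are disjoint, or all negative monomials lie in a multiple of some `x ^ γ` that splits off
with lower degree (`card_or_split`). If `h` is negative somewhere on a facet `x k = 0`, the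
inductive bound there counts the terms of `g` without `x k`, and three further terms divisible by `x
k` are enough. If there are at most two, substituting `x k = -s`, with `s` the sum of the other
variables, determines `h` on the facet (`restrict_eq_sum`, `two_terms`), and this explicit shape
provides another facet with three such terms (`card_of_restrict`).

For degree 2 a negative coefficient sits at some `x p * x q` with `p ≠ q`. The terms of `g` are
sorted by the variables they contain outside `{p, q}`, and the linear inequalities between
coefficients make singletons and most pairs contribute (`card_sq_le_sum_powerset`).

Sharpness for `n ≤ 4` comes from `(u + v) * (u² - u v + v²) = u³ + v³`. -/

namespace HermSOS

/-! ### Multiplication by the sum of the variables, facets, and splitting off a monomial. -/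

open MvPolynomial Finset

variable {σ : Type*}

/-- The linear form `∑ i ∈ I, x i`. -/
noncomputable def linSum (R : Type*) [CommSemiring R] (I : Finset σ) : MvPolynomial σ R :=
  ∑ i ∈ I, X i

theorem linSum_isHomogeneous (I : Finset σ) : (linSum ℝ I).IsHomogeneous 1 :=
  IsHomogeneous.sum _ _ _ fun i _ => isHomogeneous_X ℝ i

section

variable [DecidableEq σ]

theorem coeff_linSum_mul (I : Finset σ) (h : MvPolynomial σ ℝ) (β : σ →₀ ℕ) :
    coeff β (linSum ℝ I * h) =
      ∑ i ∈ I, if β i = 0 then 0 else coeff (β - Finsupp.single i 1) h := by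
  simp only [linSum, sum_mul, coeff_sum, coeff_X_mul']
  refine sum_congr rfl fun i _ => ?_
  by_cases hi : β i = 0 <;> simp [hi]

theorem coeff_linSum_mul_add_single {I : Finset σ} (h : MvPolynomial σ ℝ) (α : σ →₀ ℕ) {i : σ}
    (hi : i ∈ I) :
    coeff (α + Finsupp.single i 1) (linSum ℝ I * h) = coeff α h +
      ∑ j ∈ I.erase i, if α j = 0 then 0 else
        coeff (α + Finsupp.single i 1 - Finsupp.single j 1) h := by
  rw [coeff_linSum_mul, ← add_sum_erase _ _ hi]
  congr 1
  · simp
  · refine sum_congr rfl fun j hj => ?_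
    have hji : j ≠ i := (mem_erase.1 hj).1
    simp [hji.symm]

theorem coeff_linSum_mul_pos {I : Finset σ} {h : MvPolynomial σ ℝ} {α : σ →₀ ℕ} {i : σ}
    (hi : i ∈ I) (hα : 0 < coeff α h)
    (hn : ∀ j ∈ I, j ≠ i → α j ≠ 0 →
      0 ≤ coeff (α + Finsupp.single i 1 - Finsupp.single j 1) h) :
    0 < coeff (α + Finsupp.single i 1) (linSum ℝ I * h) := by
  rw [coeff_linSum_mul_add_single h α hi]
  refine add_pos_of_pos_of_nonneg hα (sum_nonneg fun j hj => ?_)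
  split_ifs with h0
  · exact le_rfl
  · exact hn j (mem_erase.1 hj).2 (mem_erase.1 hj).1 h0

/-- If `α i` is maximal among the monomials of `h`, then `x ^ α * x i` occurs in the product. -/
theorem coeff_linSum_mul_ne_zero {I : Finset σ} {h : MvPolynomial σ ℝ} {i : σ} (hi : i ∈ I)
    {α : σ →₀ ℕ}
    (hα : coeff α h ≠ 0) (hmax : ∀ α', coeff α' h ≠ 0 → α' i ≤ α i) :
    coeff (α + Finsupp.single i 1) (linSum ℝ I * h) ≠ 0 := by
  rw [coeff_linSum_mul_add_single h α hi, sum_eq_zero, add_zero]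
  · exact hα
  · intro j hj
    split_ifs with h0
    · rfl
    · by_contra hne
      have := hmax _ hne
      simp [(mem_erase.1 hj).1] at this

/-- The restriction of a polynomial to the hyperplane `x k = 0`. -/
noncomputable def restrict (k : σ) : MvPolynomial σ ℝ →ₐ[ℝ] MvPolynomial σ ℝ :=
  aeval fun i => if i = k then 0 else X i

theorem coeff_restrict (k : σ) (h : MvPolynomial σ ℝ) (β : σ →₀ ℕ) :
    coeff β (restrict k h) = if β k = 0 then coeff β h else 0 := by
  induction h using MvPolynomial.induction_on' with
  | add p q hp hq =>
    rw [map_add, coeff_add, hp, hq, coeff_add]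
    split_ifs <;> simp
  | monomial u a =>
    have hu : restrict k (monomial u a) = if u k = 0 then monomial u a else 0 := by
      rw [restrict, aeval_monomial]
      split_ifs with h0
      · rw [monomial_eq, algebraMap_eq]
        congr 1
        refine Finsupp.prod_congr fun i hi => ?_
        rw [if_neg]
        rintro rfl
        exact (Finsupp.mem_support_iff.1 hi) h0
      · rw [Finsupp.prod, prod_eq_zero (Finsupp.mem_support_iff.2 h0), mul_zero]
        simp [h0]
    rw [hu]
    by_cases hβ : u = β
    · subst hβ
      split_ifs <;> simp
    · split_ifs <;> simp [coeff_monomial, hβ]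

theorem restrict_linSum (k : σ) (I : Finset σ) :
    restrict k (linSum ℝ I) = linSum ℝ (I.erase k) := by
  simp only [linSum, map_sum, restrict, aeval_X]
  rw [sum_ite, sum_const_zero, zero_add]
  congr 1
  ext i
  simp [and_comm]

end

/-- `h` is a form of degree `d` in the variables `x i`, `i ∈ I`, with a negative coefficient, whose
product with `∑ i ∈ I, x i` has none. -/
structure IsCritical (I : Finset σ) (d : ℕ) (h : MvPolynomial σ ℝ) : Prop where
  isHomogeneous : h.IsHomogeneous d
  support_subset : ∀ α, coeff α h ≠ 0 → α.support ⊆ I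
  coeff_nonneg : ∀ β, 0 ≤ coeff β (linSum ℝ I * h)
  exists_neg : ∃ α, coeff α h < 0

namespace IsCritical

variable {I : Finset σ} {d : ℕ} {h : MvPolynomial σ ℝ}

theorem ne_zero (hc : IsCritical I d h) : h ≠ 0 := by
  rintro rfl
  obtain ⟨α, hα⟩ := hc.exists_neg
  simp at hα

theorem degree_eq (hc : IsCritical I d h) {α : σ →₀ ℕ} (hα : coeff α h ≠ 0) :
    α.degree = d := by
  by_contra hne
  exact hα (hc.isHomogeneous.coeff_eq_zero hne)

theorem degree_eq_succ (hc : IsCritical I d h) {β : σ →₀ ℕ}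
    (hβ : coeff β (linSum ℝ I * h) ≠ 0) : β.degree = d + 1 := by
  by_contra hne
  exact hβ (((linSum_isHomogeneous I).mul hc.isHomogeneous).coeff_eq_zero (by omega))

theorem degree_le (hc : IsCritical I d h) {γ α : σ →₀ ℕ} (hα : coeff α h ≠ 0) (hle : γ ≤ α) :
    γ.degree ≤ d := by
  rw [← hc.degree_eq hα]
  exact Finsupp.degree_mono hle

variable [DecidableEq σ]

/-- Restriction to a coordinate hyperplane on which a negative coefficient survives. -/
theorem restrict (hc : IsCritical I d h) {k : σ} {α : σ →₀ ℕ} (hα : coeff α h < 0)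
    (hk : α k = 0) : IsCritical (I.erase k) d (restrict k h) where
  isHomogeneous := by
    intro β hβ
    rw [coeff_restrict] at hβ
    exact hc.isHomogeneous (by by_contra h0; simp [h0] at hβ)
  support_subset β hβ := by
    rw [coeff_restrict] at hβ
    split_ifs at hβ with h0
    · exact fun i hi => mem_erase.2
        ⟨by rintro rfl; exact Finsupp.mem_support_iff.1 hi h0, hc.support_subset β hβ hi⟩
    · simp at hβ
  coeff_nonneg β := by
    rw [← restrict_linSum, ← map_mul, coeff_restrict]
    split_ifs
    exacts [hc.coeff_nonneg β, le_rfl]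
  exists_neg := ⟨α, by rwa [coeff_restrict, if_pos hk]⟩

theorem card_support_restrict (k : σ) :
    (linSum ℝ (I.erase k) * HermSOS.restrict k h).support.card =
      #{β ∈ (linSum ℝ I * h).support | β k = 0} := by
  congr 1
  ext β
  rw [← restrict_linSum, ← map_mul, mem_support_iff, coeff_restrict, mem_filter, mem_support_iff]
  by_cases h0 : β k = 0 <;> simp [h0]

/-- The part of `h` divisible by `x ^ γ` may be split off when no monomial of
`h` contributes to the coefficients of `x ^ γ * q * ∑ i ∈ I, x i` from outside. -/
theorem divMonomial (hc : IsCritical I d h) (γ : σ →₀ ℕ)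
    (hγ : ∀ α, coeff α h ≠ 0 → ∀ i ∈ I, γ i = α i + 1 → ∃ j, j ≠ i ∧ α j < γ j)
    {α : σ →₀ ℕ} (hα : coeff α h < 0) (hle : γ ≤ α) :
    IsCritical I (d - γ.degree) (h.divMonomial γ) ∧
      (linSum ℝ I * h.divMonomial γ).support.card ≤ (linSum ℝ I * h).support.card := by
  have key : ∀ β, coeff β (linSum ℝ I * h.divMonomial γ) = coeff (γ + β) (linSum ℝ I * h) := by
    intro β
    rw [coeff_linSum_mul, coeff_linSum_mul]
    refine sum_congr rfl fun i hi => ?_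
    rw [coeff_divMonomial]
    by_cases h0 : β i = 0
    · rw [if_pos h0]
      split_ifs with h1
      · rfl
      -- This contribution to `g` has no counterpart in the quotient: its monomial falls short of
      -- `γ` by one in coordinate `i` and nowhere else, which `hγ` excludes.
      · by_contra hne
        rw [eq_comm] at hne
        obtain ⟨j, hj, hlt⟩ := hγ _ hne i hi (by
          simp only [Finsupp.add_apply, h0] at h1
          simp [h0]; omega)
        simp [hj.symm] at hlt
    · rw [if_neg h0, if_neg (by simp [h0])]
      congr 1
      ext j
      by_cases hj : i = j
      · subst hj
        simp; omega
      · simp [hj]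
  refine ⟨⟨?_, ?_, ?_, ?_⟩, ?_⟩
  · intro β hβ
    rw [coeff_divMonomial] at hβ
    have := hc.degree_eq hβ
    rw [map_add] at this
    have h2 : Finsupp.degree β = d - γ.degree := by omega
    rw [← h2, Finsupp.degree_eq_weight_one]
    rfl
  · intro β hβ
    rw [coeff_divMonomial] at hβ
    intro i hi
    refine hc.support_subset _ hβ ?_
    rw [Finsupp.mem_support_iff] at hi ⊢
    simp [hi]
  · intro β
    rw [key]
    exact hc.coeff_nonneg _
  · refine ⟨α - γ, ?_⟩
    rwa [coeff_divMonomial, add_tsub_cancel_of_le hle]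
  · refine card_le_card_of_injOn (fun β => γ + β) ?_ (fun a _ b _ hab => add_left_cancel hab)
    intro β hβ
    simp only [mem_coe, mem_support_iff] at hβ ⊢
    rwa [← key]

/-- A monomial of `h` with maximal exponent of `x i`, times `x i`, survives in the product; likewise
for `x j`. The first has a larger exponent of `x i` than any monomial of `h`, so the two differ. -/
theorem two_le_card (hc : IsCritical I d h) (hI : 2 ≤ I.card) :
    2 ≤ (linSum ℝ I * h).support.card := by
  obtain ⟨i, hi, j, hj, hij⟩ := one_lt_card.1 hI
  have hne : h.support.Nonempty := by
    rw [nonempty_iff_ne_empty, Ne, support_eq_empty]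
    exact hc.ne_zero
  obtain ⟨α, hα, hαm⟩ := exists_max_image h.support (fun α => α i) hne
  obtain ⟨α', hα', hαm'⟩ := exists_max_image h.support (fun α => α j) hne
  rw [mem_support_iff] at hα hα'
  have h1 := coeff_linSum_mul_ne_zero hi hα fun α'' h'' => hαm α'' (mem_support_iff.2 h'')
  have h2 := coeff_linSum_mul_ne_zero hj hα' fun α'' h'' => hαm' α'' (mem_support_iff.2 h'')
  refine one_lt_card.2 ⟨_, mem_support_iff.2 h1, _, mem_support_iff.2 h2, fun heq => ?_⟩
  have h3 := DFunLike.congr_fun heq i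
  have h4 := hαm α' (mem_support_iff.2 hα')
  simp [hij.symm] at h3
  omega

end IsCritical

end HermSOS

/-! ### Forms that are nonnegative on every facet. -/

namespace HermSOS

open MvPolynomial Finset

variable {σ : Type*}

variable [DecidableEq σ] {I : Finset σ} {h : MvPolynomial σ ℝ}

/-- Since `i ≠ k`, every contribution to `x ^ α * x i` comes from the same facet, where nothing can
cancel. Hence each monomial on a nonnegative facet yields `I.card - 1` terms of the product. -/
theorem coeff_ne_zero_of_facet {k : σ} (hface : ∀ α : σ →₀ ℕ, α k = 0 → 0 ≤ coeff α h)
    {α : σ →₀ ℕ} (hα : coeff α h ≠ 0) (hk : α k = 0) {i : σ} (hi : i ∈ I) (hik : i ≠ k) :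
    coeff (α + Finsupp.single i 1) (linSum ℝ I * h) ≠ 0 := by
  refine (coeff_linSum_mul_pos hi ((hface α hk).lt_of_ne' hα) fun j _ _ _ => hface _ ?_).ne'
  simp [hk, hik]

/-- If `h` is nonnegative and nonzero on every facet, then either the product has many terms or the
negative part of `h` lies in a smaller form that can be split off. -/
theorem card_or_split (hI : 3 ≤ I.card)
    (hface : ∀ k ∈ I, ∀ α : σ →₀ ℕ, α k = 0 → 0 ≤ coeff α h)
    (hU : ∀ k ∈ I, ∃ α, coeff α h ≠ 0 ∧ α k = 0) :
    3 * I.card ≤ (linSum ℝ I * h).support.card + 4 ∨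
      ∃ γ : σ →₀ ℕ, γ ≠ 0 ∧ (∀ α, coeff α h < 0 → γ ≤ α) ∧
        ∀ α, coeff α h ≠ 0 → ∀ i ∈ I, γ i = α i + 1 → ∃ j, j ≠ i ∧ α j < γ j := by
  have hind : ∀ J ⊆ I, ∀ α, coeff α h < 0 → Finsupp.indicator J (fun _ _ => 1) ≤ α := by
    intro J hJ α hα i
    rw [Finsupp.indicator_apply]
    split_ifs with hi
    · by_contra hlt
      exact (hface i (hJ hi) α (by omega)).not_gt hα
    · exact Nat.zero_le _
  have hind0 : ∀ J : Finset σ, J.Nonempty →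
      (Finsupp.indicator J (fun _ _ => 1) : σ →₀ ℕ) ≠ 0 := by
    rintro J ⟨i, hi⟩ h0
    have := DFunLike.congr_fun h0 i
    simp [Finsupp.indicator_apply, hi] at this
  -- The question is whether some monomial misses exactly one variable.
  by_cases hT : ∃ k ∈ I, ∃ α, coeff α h ≠ 0 ∧ α k = 0 ∧ ∀ j ∈ I, j ≠ k → α j ≠ 0
  · obtain ⟨k, hk, α, hα, hαk, hαj⟩ := hT
    by_cases hτ : ∃ τ, coeff τ h ≠ 0 ∧ ∃ l ∈ I, l ≠ k ∧ τ l = 0 ∧ ∃ l' ∈ I, l' ≠ k ∧ τ l' ≠ 0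
    · left
      obtain ⟨τ, hτ, l, hl, hlk, hτl, l', hl', hlk', hτl'⟩ := hτ
      obtain ⟨ρ, hρ, hρl⟩ := hU l' hl'
      let S : (σ →₀ ℕ) → σ → Finset (σ →₀ ℕ) := fun α k =>
        (I.erase k).image fun i => α + Finsupp.single i 1
      have hcard : ∀ α, ∀ k ∈ I, (S α k).card = I.card - 1 := by
        intro α k hk
        rw [card_image_of_injective, card_erase_of_mem hk]
        intro i j hij
        exact (Finsupp.single_left_inj one_ne_zero).1 (add_left_cancel hij)
      have hsub : ∀ α k, k ∈ I → coeff α h ≠ 0 → α k = 0 →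
          S α k ⊆ (linSum ℝ I * h).support := by
        intro α k hk hα hαk β hβ
        obtain ⟨i, hi, rfl⟩ := mem_image.1 hβ
        exact mem_support_iff.2 (coeff_ne_zero_of_facet (hface k hk) hα hαk
          (mem_erase.1 hi).2 (mem_erase.1 hi).1)
      -- Members of the first family are divisible by `x k'`, those of the second are not.
      have hdisj : ∀ α α' k k', α k' ≠ 0 → α' k' = 0 → Disjoint (S α k) (S α' k') := by
        intro α α' k k' h1 h2
        rw [disjoint_left]
        intro β hβ hβ'
        obtain ⟨i, hi, rfl⟩ := mem_image.1 hβ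
        obtain ⟨j, hj, hij⟩ := mem_image.1 hβ'
        have := DFunLike.congr_fun hij k'
        simp [h2, (mem_erase.1 hj).1] at this
        omega
      have hd1 := hdisj α τ k l (hαj l hl hlk) hτl
      have hd2 := hdisj α ρ k l' (hαj l' hl' hlk') hρl
      have hd3 := hdisj τ ρ l l' hτl' hρl
      have hle := card_le_card (union_subset (union_subset (hsub α k hk hα hαk)
        (hsub τ l hl hτ hτl)) (hsub ρ l' hl' hρ hρl))
      rw [card_union_of_disjoint (disjoint_union_left.2 ⟨hd2, hd3⟩), card_union_of_disjoint hd1,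
        hcard _ _ hk, hcard _ _ hl, hcard _ _ hl'] at hle
      omega
    · right
      push Not at hτ
      -- Now every monomial contains all of the variables other than `x k` or none of them. Their
      -- product is split off: a monomial not divisible by it misses at least two of its factors,
      -- because `I.card ≥ 3`.
      refine ⟨_, hind0 (I.erase k) ?_, hind _ (erase_subset k I), ?_⟩
      · rw [← card_pos, card_erase_of_mem hk]
        omega
      · intro β hβ i hi hγ
        rw [Finsupp.indicator_apply] at hγ
        split_ifs at hγ with hik
        have hβi : β i = 0 := by omega
        obtain ⟨j, hj⟩ : ((I.erase k).erase i).Nonempty := by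
          rw [← card_pos, card_erase_of_mem hik, card_erase_of_mem hk]
          omega
        obtain ⟨hji, hjk, hjI⟩ : j ≠ i ∧ j ≠ k ∧ j ∈ I := by simpa using hj
        refine ⟨j, hji, ?_⟩
        rw [hτ β hβ i hi (mem_erase.1 hik).1 hβi j hjI hjk]
        simp [Finsupp.indicator_apply, hjk, hjI]
  · right
    push Not at hT
    -- A monomial that misses one variable misses a second one, so the product of all variables can
    -- be split off.
    refine ⟨_, hind0 I (card_pos.1 (by omega)), hind _ subset_rfl, ?_⟩
    intro β hβ i hi hγ
    simp only [Finsupp.indicator_apply, hi, dite_true] at hγ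
    obtain ⟨j, hj, hji, hβj⟩ := hT i hi β hβ (by omega)
    exact ⟨j, hji, by simp [Finsupp.indicator_apply, hj, hβj]⟩

end HermSOS

/-! ### Powers of the sum of the variables, and the substitution that recovers a facet. -/

namespace HermSOS

open MvPolynomial Finset

variable {σ : Type*}

theorem monomial_mul_coeff_nonneg {f : MvPolynomial σ ℝ} (hf : ∀ β, 0 ≤ coeff β f) {c : ℝ}
    (hc : 0 ≤ c) (m β : σ →₀ ℕ) : 0 ≤ coeff β (monomial m c * f) := by
  rw [coeff_monomial_mul']
  split_ifs
  exacts [mul_nonneg hc (hf _), le_rfl]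

variable [DecidableEq σ]

theorem coeff_linSum_mul_nonneg {J : Finset σ} {f : MvPolynomial σ ℝ} (hf : ∀ β, 0 ≤ coeff β f)
    (β : σ →₀ ℕ) : 0 ≤ coeff β (linSum ℝ J * f) := by
  rw [coeff_linSum_mul]
  refine sum_nonneg fun i _ => ?_
  split_ifs
  exacts [le_rfl, hf _]

theorem coeff_linSum_pow_nonneg (J : Finset σ) (a : ℕ) (β : σ →₀ ℕ) :
    0 ≤ coeff β (linSum ℝ J ^ a) := by
  induction a generalizing β with
  | zero => rw [pow_zero, coeff_one]; split_ifs <;> simp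
  | succ a ih => rw [pow_succ']; exact coeff_linSum_mul_nonneg ih β

theorem coeff_le_coeff_linSum_mul {J : Finset σ} {f : MvPolynomial σ ℝ}
    (hf : ∀ β, 0 ≤ coeff β f) {i : σ} (hi : i ∈ J) (β : σ →₀ ℕ) :
    coeff β f ≤ coeff (β + Finsupp.single i 1) (linSum ℝ J * f) := by
  rw [coeff_linSum_mul_add_single f β hi]
  refine le_add_of_nonneg_right (sum_nonneg fun j _ => ?_)
  split_ifs
  exacts [le_rfl, hf _]

theorem coeff_linSum_pow_le {J : Finset σ} {i : σ} (hi : i ∈ J) (a t : ℕ) (β : σ →₀ ℕ) :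
    coeff β (linSum ℝ J ^ a) ≤ coeff (β + Finsupp.single i t) (linSum ℝ J ^ (a + t)) := by
  induction t with
  | zero => simp
  | succ t ih =>
    rw [← add_assoc, pow_succ', Finsupp.single_add, ← add_assoc]
    exact ih.trans (coeff_le_coeff_linSum_mul (coeff_linSum_pow_nonneg J _) hi _)

theorem coeff_linSum_pow_pos {J : Finset σ} (a : ℕ) {β : σ →₀ ℕ} (hβ : β.support ⊆ J)
    (hd : β.degree = a) : 0 < coeff β (linSum ℝ J ^ a) := by
  induction a generalizing β with
  | zero =>
    rw [Finsupp.degree_eq_zero_iff] at hd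
    simp [hd]
  | succ a ih =>
    have hne : β ≠ 0 := by rintro rfl; simp at hd
    obtain ⟨i, hi⟩ := Finsupp.support_nonempty_iff.2 hne
    have hle : Finsupp.single i 1 ≤ β :=
      Finsupp.single_le_iff.2 (Nat.one_le_iff_ne_zero.2 (Finsupp.mem_support_iff.1 hi))
    obtain ⟨γ, rfl⟩ := exists_add_of_le hle
    rw [map_add, Finsupp.degree_single] at hd
    rw [pow_succ', add_comm]
    refine (ih ?_ (by omega)).trans_le
      (coeff_le_coeff_linSum_mul (coeff_linSum_pow_nonneg J _) (hβ hi) _)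
    intro j hj
    refine hβ (Finsupp.mem_support_iff.2 ?_)
    have := Finsupp.mem_support_iff.1 hj
    simp [this]

theorem coeff_linSum_mul_add_single_self {J : Finset σ} (f : MvPolynomial σ ℝ) {i : σ}
    (hi : i ∈ J) (a : ℕ) :
    coeff (Finsupp.single i (a + 1)) (linSum ℝ J * f) = coeff (Finsupp.single i a) f := by
  rw [Finsupp.single_add, coeff_linSum_mul_add_single f _ hi, sum_eq_zero, add_zero]
  intro j hj
  rw [if_pos]
  simp [(mem_erase.1 hj).1]

theorem coeff_linSum_pow_single {J : Finset σ} {i : σ} (hi : i ∈ J) (a : ℕ) :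
    coeff (Finsupp.single i a) (linSum ℝ J ^ a) = 1 := by
  induction a with
  | zero => simp
  | succ a ih => rw [pow_succ', coeff_linSum_mul_add_single_self _ hi, ih]

theorem linSum_ne_zero {J : Finset σ} (hJ : J.Nonempty) : linSum ℝ J ≠ 0 := by
  obtain ⟨i, hi⟩ := hJ
  intro h0
  have := coeff_linSum_pow_single hi 1
  simp [h0] at this

/-- Substituting `x k = -∑ i ∈ I \ {k}, x i` in the product recovers the restriction of `h` to
`x k = 0` from the terms of the product that are divisible by `x k`. -/
theorem restrict_eq_sum {I : Finset σ} {k : σ} (hk : k ∈ I) (hI : (I.erase k).Nonempty)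
    (h : MvPolynomial σ ℝ) :
    restrict k h = ∑ β ∈ (linSum ℝ I * h).support with β k ≠ 0,
      monomial (β.erase k) (coeff β (linSum ℝ I * h)) *
        (-linSum ℝ (I.erase k)) ^ (β k - 1) := by
  set s := linSum ℝ (I.erase k) with hs
  set g := linSum ℝ I * h with hg
  let φ : MvPolynomial σ ℝ →ₐ[ℝ] MvPolynomial σ ℝ := aeval fun i => if i = k then -s else X i
  have hφI : φ (linSum ℝ I) = 0 := by
    rw [linSum, ← add_sum_erase _ _ hk, map_add, map_sum]
    simp only [φ, aeval_X, if_true]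
    rw [neg_add_eq_zero, hs, linSum]
    exact sum_congr rfl fun i hi => by rw [if_neg (mem_erase.1 hi).1]
  have hφm : ∀ (β : σ →₀ ℕ) (c : ℝ), φ (monomial β c) = monomial (β.erase k) c * (-s) ^ (β k) := by
    intro β c
    have hβ : monomial β c = monomial (β.erase k) c * X k ^ (β k) := by
      rw [X_pow_eq_monomial, monomial_mul, Finsupp.erase_add_single, mul_one]
    rw [hβ, map_mul, map_pow]
    congr 1
    · simp only [φ]
      rw [aeval_monomial, monomial_eq, algebraMap_eq]
      congr 1
      refine Finsupp.prod_congr fun i hi => ?_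
      rw [if_neg]
      rintro rfl
      simp at hi
    · simp [φ]
  have hsum : (0 : MvPolynomial σ ℝ) = ∑ β ∈ g.support, φ (monomial β (coeff β g)) := by
    rw [← map_sum, support_sum_monomial_coeff, hg, map_mul, hφI, zero_mul]
  have hres : restrict k g = ∑ β ∈ g.support with β k = 0, φ (monomial β (coeff β g)) := by
    conv_lhs => rw [← support_sum_monomial_coeff g, map_sum]
    rw [sum_filter]
    refine sum_congr rfl fun β _ => ?_
    ext γ
    rw [coeff_restrict]
    split_ifs with h1 h2 h2
    · rw [hφm, h2, Finsupp.erase_of_notMem_support (by simpa using h2)]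
      simp
    · rw [coeff_monomial, if_neg (by rintro rfl; exact h2 h1), coeff_zero]
    · rw [hφm, h2, Finsupp.erase_of_notMem_support (by simpa using h2), pow_zero, mul_one,
        coeff_monomial, if_neg (by rintro rfl; exact h1 h2)]
    · rfl
  rw [← sum_filter_add_sum_filter_not _ (fun β => β k = 0), ← hres, hg, map_mul,
    restrict_linSum, ← hg, ← hs] at hsum
  -- With `x k = -s` the product vanishes; its part free of `x k` is `s` times the restriction of
  -- `h`, and one factor `s` cancels.
  refine mul_left_cancel₀ (linSum_ne_zero hI) ?_
  rw [← hs, eq_neg_of_add_eq_zero_left hsum.symm, ← sum_neg_distrib, mul_sum]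
  refine sum_congr rfl fun β hβ => ?_
  rw [hφm]
  have h0 : β k ≠ 0 := (mem_filter.1 hβ).2
  conv_lhs => rw [← Nat.sub_add_cancel (Nat.one_le_iff_ne_zero.2 h0), pow_succ]
  ring

namespace IsCritical

variable {I : Finset σ} {d : ℕ} {h : MvPolynomial σ ℝ}

theorem support_mul_subset (hc : IsCritical I d h) {β : σ →₀ ℕ}
    (hβ : coeff β (linSum ℝ I * h) ≠ 0) : β.support ⊆ I := by
  rw [coeff_linSum_mul] at hβ
  obtain ⟨i, hi, hne⟩ := exists_ne_zero_of_sum_ne_zero hβ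
  split_ifs at hne with h0
  · exact absurd rfl hne
  · intro j hj
    by_cases hij : j = i
    · exact hij ▸ hi
    · refine hc.support_subset _ hne (Finsupp.mem_support_iff.2 ?_)
      have := Finsupp.mem_support_iff.1 hj
      simpa [Ne.symm hij] using this

/-- If a negative coefficient survives on `x k = 0` and at most two terms of the product are
divisible by `x k`, then there are two such terms, of opposite parity in `x k`. -/
theorem two_terms (hc : IsCritical I d h) {k : σ} (hk : k ∈ I) (hI : (I.erase k).Nonempty)
    {α : σ →₀ ℕ} (hα : coeff α h < 0) (hαk : α k = 0)
    (hA : #{β ∈ (linSum ℝ I * h).support | β k ≠ 0} ≤ 2) :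
    ∃ p q, 0 < coeff p (linSum ℝ I * h) ∧ 0 < coeff q (linSum ℝ I * h) ∧
      Odd (p k) ∧ Even (q k) ∧ q k ≠ 0 ∧
      (∀ β, coeff β (linSum ℝ I * h) ≠ 0 → β k ≠ 0 → β = p ∨ β = q) ∧
      HermSOS.restrict k h =
        monomial (p.erase k) (coeff p (linSum ℝ I * h)) * linSum ℝ (I.erase k) ^ (p k - 1) -
        monomial (q.erase k) (coeff q (linSum ℝ I * h)) * linSum ℝ (I.erase k) ^ (q k - 1) := by
  set g := linSum ℝ I * h with hg
  set A := {β ∈ g.support | β k ≠ 0} with hAdef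
  have hpos : ∀ β ∈ A, 0 < coeff β g := fun β hβ =>
    (hc.coeff_nonneg β).lt_of_ne' (mem_support_iff.1 (mem_filter.1 hβ).1)
  have hα0 : coeff α (HermSOS.restrict k h) < 0 := by rwa [coeff_restrict, if_pos hαk]
  have hodd : ∀ β ∈ A, Odd (β k) →
      (-linSum ℝ (I.erase k)) ^ (β k - 1) = linSum ℝ (I.erase k) ^ (β k - 1) := by
    intro β _ ho
    exact Even.neg_pow (by obtain ⟨r, hr⟩ := ho; exact ⟨r, by omega⟩) _
  have heven : ∀ β ∈ A, Even (β k) →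
      (-linSum ℝ (I.erase k)) ^ (β k - 1) = -linSum ℝ (I.erase k) ^ (β k - 1) := by
    intro β hβ he
    refine Odd.neg_pow ?_ _
    have h0 : β k ≠ 0 := (mem_filter.1 hβ).2
    obtain ⟨r, hr⟩ := he
    exact ⟨r - 1, by omega⟩
  have hform := restrict_eq_sum hk hI h
  -- If every exponent of `x k` were odd, all signs in `restrict_eq_sum` would be positive and the
  -- restriction would have no negative coefficient.
  obtain ⟨q, hqA, hq⟩ : ∃ q ∈ A, Even (q k) := by
    by_contra! hcon
    refine hα0.not_ge ?_
    rw [hform, coeff_sum]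
    refine sum_nonneg fun β hβ => ?_
    rw [hodd β hβ (Nat.not_even_iff_odd.1 (hcon β hβ))]
    exact monomial_mul_coeff_nonneg (coeff_linSum_pow_nonneg _ _) (hpos β hβ).le _ _
  -- If every exponent were even, the restriction would have no positive coefficient while its
  -- product with `s` has no negative one. That product, hence the restriction, would vanish.
  obtain ⟨p, hpA, hp⟩ : ∃ p ∈ A, Odd (p k) := by
    by_contra! hcon
    have hneg : ∀ β, coeff β (HermSOS.restrict k h) ≤ 0 := by
      intro β
      rw [hform, coeff_sum]
      refine sum_nonpos fun γ hγ => ?_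
      rw [heven γ hγ (Nat.not_odd_iff_even.1 (hcon γ hγ)), mul_neg, coeff_neg, neg_nonpos]
      exact monomial_mul_coeff_nonneg (coeff_linSum_pow_nonneg _ _) (hpos γ hγ).le _ _
    have hzero : linSum ℝ (I.erase k) * HermSOS.restrict k h = 0 := by
      ext β
      refine le_antisymm ?_ ((hc.restrict hα hαk).coeff_nonneg β)
      rw [coeff_linSum_mul]
      refine sum_nonpos fun i _ => ?_
      split_ifs
      exacts [le_rfl, hneg _]
    rcases mul_eq_zero.1 hzero with h1 | h1
    · exact linSum_ne_zero hI h1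
    · rw [h1] at hα0
      simp at hα0
  have hpq : p ≠ q := by
    rintro rfl
    exact (Nat.not_even_iff_odd.2 hp) hq
  have hApq : A = {p, q} :=
    (eq_of_subset_of_card_le (by simp [insert_subset_iff, hpA, hqA])
      (by rwa [card_pair hpq])).symm
  refine ⟨p, q, hpos p hpA, hpos q hqA, hp, hq, (mem_filter.1 hqA).2, ?_, ?_⟩
  · intro β hβ hβk
    have : β ∈ A := mem_filter.2 ⟨mem_support_iff.2 hβ, hβk⟩
    simpa [hApq] using this
  · rw [hform, ← hg, ← hAdef, hApq, sum_pair hpq, hodd p hpA hp, heven q hqA hq, mul_neg,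
      sub_eq_add_neg]

end IsCritical

end HermSOS

/-! ### Forms that are negative on some facet, and the bound `3m - 4`. -/

namespace HermSOS

open MvPolynomial Finset

variable {σ : Type*} [DecidableEq σ]

/-- Restriction to `x i = 0` is a ring homomorphism into a domain, so if `x i` does not divide `h`,
it does not divide the product either. -/
theorem exists_coeff_ne_zero_of_mul {I : Finset σ} {i : σ} (hI : (I.erase i).Nonempty)
    {h : MvPolynomial σ ℝ} {α : σ →₀ ℕ} (hα : coeff α h ≠ 0) (hi : α i = 0) :
    ∃ β, coeff β (linSum ℝ I * h) ≠ 0 ∧ β i = 0 := by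
  have h1 : restrict i h ≠ 0 := by
    intro h0
    have := coeff_restrict i h α
    rw [h0, if_pos hi, coeff_zero] at this
    exact hα this.symm
  have h2 : restrict i (linSum ℝ I * h) ≠ 0 := by
    rw [map_mul, restrict_linSum]
    exact mul_ne_zero (linSum_ne_zero hI) h1
  obtain ⟨β, hβ⟩ := ne_zero_iff.1 h2
  rw [coeff_restrict] at hβ
  split_ifs at hβ with h0
  · exact ⟨β, hβ, h0⟩
  · exact absurd rfl hβ

/-- With `s` the sum of the variables in `J`, the form `P * s ^ a - Q * x y ^ t * s ^ b` has
nonnegative coefficients when `y ∈ J` and `Q ≤ P`. -/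
theorem sub_coeff_nonneg_of_single {J : Finset σ} {y : σ} (hy : y ∈ J) {a b t : ℕ}
    (hab : a = b + t) {P Q : ℝ} (hP : 0 ≤ P) (hQP : Q ≤ P) (β : σ →₀ ℕ) :
    0 ≤ coeff β (monomial 0 P * linSum ℝ J ^ a -
      monomial (Finsupp.single y t) Q * linSum ℝ J ^ b) := by
  rw [coeff_sub, monomial_zero', coeff_C_mul, coeff_monomial_mul']
  split_ifs with hle
  · obtain ⟨γ, rfl⟩ := exists_add_of_le hle
    -- Choosing `y` from `t` of the factors shows that `s ^ (b + t)` dominates `x y ^ t * s ^ b`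
    -- coefficientwise.
    rw [add_tsub_cancel_left, sub_nonneg, add_comm, hab]
    exact mul_le_mul hQP (coeff_linSum_pow_le hy b t γ) (coeff_linSum_pow_nonneg _ _ _) hP
  · rw [sub_zero]
    exact mul_nonneg hP (coeff_linSum_pow_nonneg _ _ _)

namespace IsCritical

variable {I : Finset σ} {d : ℕ} {h : MvPolynomial σ ℝ}

/-- If fewer than three terms of `g` contain `x k`, then on `x k = 0` the product is `P * x ^ p' * s
^ (p k) - Q * x ^ μ * s ^ (q k)`, where `p'` and `μ` are `p` and `q` without `x k`. Nonnegativity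
and `hU` force `p' = 0`, and the negative coefficient forces `μ` to involve two variables `y₁` and
`y₂`. The argument then moves to the facet `x y₁ = 0`. -/
theorem card_of_restrict (hc : IsCritical I d h) (hI : 3 ≤ I.card)
    (hU : ∀ i ∈ I, ∃ α, coeff α h ≠ 0 ∧ α i = 0)
    (ih : ∀ i ∈ I, ∀ h', IsCritical (I.erase i) d h' →
      3 * (I.erase i).card ≤ (linSum ℝ (I.erase i) * h').support.card + 4)
    {k : σ} (hk : k ∈ I) {α : σ →₀ ℕ} (hα : coeff α h < 0) (hαk : α k = 0) :
    3 * I.card ≤ (linSum ℝ I * h).support.card + 4 := by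
  have key : ∀ i ∈ I, (∃ α, coeff α h < 0 ∧ α i = 0) →
      3 ≤ #{β ∈ (linSum ℝ I * h).support | β i ≠ 0} →
      3 * I.card ≤ (linSum ℝ I * h).support.card + 4 := by
    rintro i hi ⟨α, hα, hαi⟩ h3
    have h1 := ih i hi _ (hc.restrict hα hαi)
    rw [card_support_restrict, card_erase_of_mem hi] at h1
    have h2 := card_filter_add_card_filter_not (s := (linSum ℝ I * h).support) (fun β => β i = 0)
    simp only [ne_eq] at h3
    omega
  by_cases hA : 3 ≤ #{β ∈ (linSum ℝ I * h).support | β k ≠ 0}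
  · exact key k hk ⟨α, hα, hαk⟩ hA
  obtain ⟨i₁, hi₁, i₂, hi₂, hi₁₂⟩ : ∃ i ∈ I.erase k, ∃ j ∈ I.erase k, i ≠ j := by
    rw [← one_lt_card, card_erase_of_mem hk]
    omega
  have hIk : (I.erase k).Nonempty := ⟨i₁, hi₁⟩
  have hIne : ∀ i, (I.erase i).Nonempty := fun i => by
    rw [← card_pos]
    have := pred_card_le_card_erase (s := I) (a := i)
    omega
  obtain ⟨p, q, hp, hq, hpo, hqe, hq0, hpq, hres⟩ := hc.two_terms hk hIk hα hαk (by omega)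
  have hp0 : p k ≠ 0 := by rintro h0; rw [h0] at hpo; simp at hpo
  set g := linSum ℝ I * h with hg
  set s := linSum ℝ (I.erase k) with hs
  set P := coeff p g with hPdef
  set Q := coeff q g with hQdef
  set μ := q.erase k with hμ
  have hgres : HermSOS.restrict k g = monomial (p.erase k) P * s ^ (p k) - monomial μ Q * s ^ (q k) := by
    rw [hg, map_mul, restrict_linSum, hres, ← hs]
    conv_rhs => rw [← Nat.sub_add_cancel (Nat.one_le_iff_ne_zero.2 hp0),
      ← Nat.sub_add_cancel (Nat.one_le_iff_ne_zero.2 hq0), pow_succ, pow_succ]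
    ring
  have hgres' : ∀ β : σ →₀ ℕ, β k = 0 → coeff β g =
      coeff β (monomial (p.erase k) P * s ^ (p k)) - coeff β (monomial μ Q * s ^ (q k)) := by
    intro β hβ
    rw [← coeff_sub, ← hgres, coeff_restrict, if_pos hβ]
  have hμk : μ k = 0 := by simp [hμ]
  have hμi : ∀ i, i ≠ k → μ i = q i := fun i hi => by simp [hμ, hi]
  -- the term of odd degree in `x k` is a pure power of `x k`
  have hple : ∀ i ∈ I.erase k, p.erase k ≤ μ + Finsupp.single i (q k) := by
    intro i hi
    by_contra hnle
    have h1 := hgres' (μ + Finsupp.single i (q k)) (by simp [hμk, (mem_erase.1 hi).1])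
    rw [coeff_monomial_mul', if_neg hnle, zero_sub, coeff_monomial_mul, hs,
      coeff_linSum_pow_single hi, mul_one] at h1
    have := hc.coeff_nonneg (μ + Finsupp.single i (q k))
    rw [← hg, h1] at this
    linarith
  -- For each coordinate one of `i₁`, `i₂` differs from it, and there the extra power of a variable
  -- does not help.
  have hpμ : ∀ i, p.erase k i ≤ μ i := by
    intro i
    by_cases hi : i = i₁
    · have := hple i₂ hi₂ i
      simpa [hi, hi₁₂.symm] using this
    · have := hple i₁ hi₁ i
      simpa [Ne.symm hi] using this
  have hpzero : p.erase k = 0 := by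
    ext i
    by_contra hne
    have hik : i ≠ k := by rintro rfl; simp at hne
    have hpi : p i ≠ 0 := by simpa [hik] using hne
    have hiI : i ∈ I := hc.support_mul_subset hp.ne' (Finsupp.mem_support_iff.2 hpi)
    have hμi0 : μ i ≠ 0 := fun h0 => hne (Nat.le_zero.1 (h0 ▸ hpμ i))
    -- A variable of `p'` also divides `x ^ μ`, hence every term of `g`, contrary to `hU`.
    obtain ⟨α', hα', hαi⟩ := hU i hiI
    obtain ⟨β, hβ, hβi⟩ := exists_coeff_ne_zero_of_mul (hIne i) hα' hαi
    by_cases hβk : β k = 0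
    · rw [← hg, hgres' β hβk, coeff_monomial_mul', coeff_monomial_mul', if_neg, if_neg] at hβ
      · simp at hβ
      · exact fun hle => hμi0 (Nat.le_zero.1 (hβi ▸ hle i))
      · exact fun hle => hne (Nat.le_zero.1 (hβi ▸ hle i))
    · rcases hpq β hβ hβk with rfl | rfl
      · exact hpi hβi
      · rw [hμi i hik] at hμi0
        exact hμi0 hβi
  rw [hpzero] at hgres' hres
  have hpsingle : p = Finsupp.single k (p k) := by
    rw [← Finsupp.erase_add_single k p, hpzero]
    simp
  have hdp : p k = d + 1 := by
    have := hc.degree_eq_succ hp.ne'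
    rwa [hpsingle, Finsupp.degree_single] at this
  have hdq : q k + μ.degree = d + 1 := by
    have := hc.degree_eq_succ hq.ne'
    rwa [← Finsupp.single_add_erase k q, map_add, Finsupp.degree_single] at this
  have hμdeg : Odd μ.degree := by
    have : Odd (q k + μ.degree) := by rw [hdq, ← hdp]; exact hpo
    rcases Nat.even_or_odd μ.degree with he | ho
    · exact absurd (hqe.add he) (Nat.not_even_iff_odd.2 this)
    · exact ho
  have hq2 : 2 ≤ q k := by obtain ⟨r, hr⟩ := hqe; omega
  -- the other one is not
  have himpure : ∀ y ∈ I.erase k, μ ≠ Finsupp.single y (μ.degree) := by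
    intro y hy hpure
    have h1 := hgres' (Finsupp.single y (p k)) (by simp [(mem_erase.1 hy).1])
    have h2 : Finsupp.single y (p k) = Finsupp.single y μ.degree + Finsupp.single y (q k) := by
      rw [← Finsupp.single_add, hdp, ← hdq, add_comm]
    have h3 : coeff (Finsupp.single y (p k)) (monomial μ Q * s ^ (q k)) = Q := by
      rw [h2, ← hpure, coeff_monomial_mul, hs, coeff_linSum_pow_single hy, mul_one]
    rw [h3, monomial_zero', coeff_C_mul, hs, coeff_linSum_pow_single hy,
      mul_one] at h1
    have hQP : Q ≤ P := by
      have := hc.coeff_nonneg (Finsupp.single y (p k))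
      rw [← hg, h1] at this
      linarith
    have h4 : coeff α (HermSOS.restrict k h) < 0 := by rwa [coeff_restrict, if_pos hαk]
    rw [hres, hpure] at h4
    exact h4.not_ge (sub_coeff_nonneg_of_single hy (by omega) hp.le hQP α)
  have hμI : ∀ y, μ y ≠ 0 → y ∈ I.erase k := by
    intro y hy
    have hyk : y ≠ k := by rintro rfl; exact hy hμk
    rw [hμi y hyk] at hy
    exact mem_erase.2 ⟨hyk, hc.support_mul_subset hq.ne' (Finsupp.mem_support_iff.2 hy)⟩
  obtain ⟨y₁, hy₁⟩ : ∃ y, μ y ≠ 0 := by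
    by_contra! hcon
    have : μ = 0 := Finsupp.ext hcon
    rw [this] at hμdeg
    simp at hμdeg
  obtain ⟨y₂, hy₂, hy₁₂⟩ : ∃ y, μ y ≠ 0 ∧ y ≠ y₁ := by
    by_contra! hcon
    refine himpure y₁ (hμI y₁ hy₁) ?_
    have hμs : μ = Finsupp.single y₁ (μ y₁) := by
      ext y
      by_cases hy : y = y₁
      · simp [hy]
      · rw [Finsupp.single_apply, if_neg (Ne.symm hy)]
        by_contra h0
        exact hy (hcon y h0)
    conv_rhs => rw [hμs, Finsupp.degree_single]
    exact hμs
  have hy₁I := hμI y₁ hy₁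
  have hy₂I := hμI y₂ hy₂
  have hy₁k : y₁ ≠ k := (mem_erase.1 hy₁I).1
  have hy₂k : y₂ ≠ k := (mem_erase.1 hy₂I).1
  have hterm : ∀ β : σ →₀ ℕ, β.support ⊆ I.erase k → β.degree = d + 1 → ¬ μ ≤ β →
      0 < coeff β g := by
    intro β hβ hβd hμβ
    have hβk : β k = 0 := by
      by_contra h0
      exact (mem_erase.1 (hβ (Finsupp.mem_support_iff.2 h0))).1 rfl
    rw [hgres' β hβk, monomial_zero', coeff_C_mul, coeff_monomial_mul', if_neg hμβ, sub_zero]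
    exact mul_pos hp (coeff_linSum_pow_pos _ hβ (by omega))
  have hpuresupp : ∀ y ∈ I.erase k, ∀ c : ℕ, (Finsupp.single y c).support ⊆ I.erase k := by
    intro y hy c
    exact Finsupp.support_single_subset.trans (singleton_subset_iff.2 hy)
  have hmixsupp : ∀ y ∈ I.erase k, ∀ y' ∈ I.erase k, ∀ c c' : ℕ,
      (Finsupp.single y c + Finsupp.single y' c').support ⊆ I.erase k := by
    intro y hy y' hy' c c'
    exact Finsupp.support_add.trans (union_subset (hpuresupp y hy c) (hpuresupp y' hy' c'))
  have hd2 : 2 ≤ d := by obtain ⟨r, hr⟩ := hμdeg; omega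
  refine key y₁ (mem_erase.1 hy₁I).2 ?_ ?_
  · -- a negative coefficient next to a power of `x y₂`
    have h1 : 0 < coeff (Finsupp.single y₂ (d + 1)) g := by
      refine hterm _ (hpuresupp y₂ hy₂I _) (Finsupp.degree_single _ _) fun hle => hy₁ ?_
      have := hle y₁
      simpa [hy₁₂] using this
    rw [hg, coeff_linSum_mul_add_single_self _ (mem_erase.1 hy₂I).2] at h1
    -- Only `p` and `q` contain `x k`, and both with exponent at least 2. Since `x y₂ ^ d` has
    -- positive coefficient in `h`, its neighbour `x y₂ ^ (d - 1) * x k` must have a negative one,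
    -- and it does not involve `y₁`.
    have h2 : coeff (Finsupp.single y₂ d + Finsupp.single k 1) g = 0 := by
      by_contra hne
      rcases hpq _ hne (by simp) with h0 | h0
      · have := DFunLike.congr_fun h0 k
        simp [hy₂k] at this
        omega
      · have := DFunLike.congr_fun h0 k
        simp [hy₂k] at this
        omega
    rw [hg, coeff_linSum_mul_add_single _ _ hk, sum_eq_single y₂] at h2
    · rw [if_neg (by simp; omega)] at h2
      exact ⟨_, by linarith, by simp [hy₁₂, hy₁k.symm]⟩
    · intro j _ hj
      rw [if_pos]
      simp [hj]
    · exact fun hn => absurd hy₂I hn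
  -- If `x ^ μ` divided both `x y₁ * x y₂ ^ d` and `x y₁ ^ d * x y₂`, it would be `x y₁ * x y₂`, of
  -- even degree, whereas `μ` has odd degree. The three terms containing `y₁` are then `x y₁ ^ (d +
  -- 1)`, this mixed one and `q`.
  · have hlt : ∃ β : σ →₀ ℕ, coeff β g ≠ 0 ∧ β y₁ ≠ 0 ∧ β y₂ ≠ 0 ∧ β k = 0 := by
      by_cases hle : μ ≤ Finsupp.single y₁ 1 + Finsupp.single y₂ d
      · refine ⟨Finsupp.single y₁ d + Finsupp.single y₂ 1,
          (hterm _ (hmixsupp _ hy₁I _ hy₂I _ _) (by simp) fun hle' => ?_).ne', ?_, ?_, ?_⟩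
        · have hμ2 : μ = Finsupp.single y₁ 1 + Finsupp.single y₂ 1 := by
            ext y
            have e1 := hle y
            have e2 := hle' y
            by_cases hya : y = y₁
            · subst hya
              simp [hy₁₂] at e1 e2 ⊢
              omega
            · by_cases hyb : y = y₂
              · subst hyb
                simp [hy₁₂.symm] at e1 e2 ⊢
                omega
              · simp [Ne.symm hya, Ne.symm hyb] at e1 e2 ⊢
                exact e1
          rw [hμ2] at hμdeg
          simp at hμdeg
          exact absurd hμdeg (by decide)
        · simp [hy₁₂]; omega
        · simp
        · simp [hy₁k, hy₂k]
      · refine ⟨_, (hterm _ (hmixsupp _ hy₁I _ hy₂I _ _) (by simp [add_comm]) hle).ne', ?_, ?_, ?_⟩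
        · simp
        · simp [hy₁₂.symm]; omega
        · simp [hy₁k, hy₂k]
    obtain ⟨β, hβ, hβ₁, hβ₂, hβk⟩ := hlt
    have h1 : 0 < coeff (Finsupp.single y₁ (d + 1)) g := by
      refine hterm _ (hpuresupp y₁ hy₁I _) (Finsupp.degree_single _ _) fun hle => hy₂ ?_
      have := hle y₂
      simpa [hy₁₂.symm] using this
    refine two_lt_card.2 ⟨Finsupp.single y₁ (d + 1), ?_, β, ?_, q, ?_, ?_, ?_, ?_⟩
    · simpa using h1.ne'
    · simpa using ⟨hβ, hβ₁⟩
    · rw [hμi y₁ hy₁k] at hy₁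
      simpa using ⟨hq.ne', hy₁⟩
    · rintro rfl
      simp [hy₁₂.symm] at hβ₂
    · intro h0
      have := DFunLike.congr_fun h0 k
      simp [hy₁k] at this
      omega
    · rintro rfl
      exact hq0 hβk

/-- A form in `m` variables with a negative coefficient whose product with the sum of the variables
has none: the product has at least `3 m - 4` terms. -/
theorem three_mul_card_le {I : Finset σ} {d : ℕ} {h : MvPolynomial σ ℝ}
    (hc : IsCritical I d h) : 3 * I.card ≤ (linSum ℝ I * h).support.card + 4 := by
  induction hn : I.card using Nat.strong_induction_on generalizing I d h with
  | _ n ihn =>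
  subst hn
  induction d using Nat.strong_induction_on generalizing h with
  | _ d ihd =>
  -- For at most one variable the bound is vacuous; for two it is `two_le_card`.
  rcases lt_or_ge I.card 2 with h1 | h1
  · omega
  have h2 := hc.two_le_card h1
  rcases h1.eq_or_lt with h3 | h3
  · omega
  have hsplit : (∃ γ : σ →₀ ℕ, γ ≠ 0 ∧ (∀ α, coeff α h < 0 → γ ≤ α) ∧
      ∀ α, coeff α h ≠ 0 → ∀ i ∈ I, γ i = α i + 1 → ∃ j, j ≠ i ∧ α j < γ j) →
      3 * I.card ≤ (linSum ℝ I * h).support.card + 4 := by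
    rintro ⟨γ, hγ0, hle, hγ⟩
    obtain ⟨α, hα⟩ := hc.exists_neg
    obtain ⟨hc', hcard⟩ := hc.divMonomial γ hγ hα (hle α hα)
    have hγd := hc.degree_le hα.ne (hle α hα)
    have hγ1 : γ.degree ≠ 0 := by rwa [Ne, Finsupp.degree_eq_zero_iff]
    have := ihd (d - γ.degree) (by omega) hc'
    omega
  by_cases hU : ∀ i ∈ I, ∃ α, coeff α h ≠ 0 ∧ α i = 0
  · by_cases hface : ∀ k ∈ I, ∀ α : σ →₀ ℕ, α k = 0 → 0 ≤ coeff α h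
    · exact (card_or_split h3 hface hU).elim id hsplit
    · push Not at hface
      obtain ⟨k, hk, α, hαk, hα⟩ := hface
      refine hc.card_of_restrict h3 hU (fun i hi h' hc' => ?_) hk hα hαk
      exact ihn _ (card_erase_lt_of_mem hi) hc' rfl
  · push Not at hU
    obtain ⟨k, hk, hU⟩ := hU
    refine hsplit ⟨Finsupp.single k 1, by simp, fun α hα => ?_, fun α hα i hi hαi => ?_⟩
    · exact Finsupp.single_le_iff.2 (Nat.one_le_iff_ne_zero.2 (hU α hα.ne))
    · by_cases hik : k = i
      · subst hik
        have := hU α hα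
        simp at hαi
        omega
      · simp [Ne.symm hik] at hαi

end IsCritical

end HermSOS

/-! ### Quadratic forms: the bound of order `m²`. -/

namespace HermSOS

open MvPolynomial Finset

variable {σ : Type*}

theorem eq_single_add_single_of_degree {α : σ →₀ ℕ} (hα : α.degree = 2) :
    ∃ i j, α = Finsupp.single i 1 + Finsupp.single j 1 := by
  have step : ∀ γ : σ →₀ ℕ, γ ≠ 0 → ∃ i γ', γ = Finsupp.single i 1 + γ' := by
    intro γ hγ
    obtain ⟨i, hi⟩ := Finsupp.support_nonempty_iff.2 hγ
    exact ⟨i, exists_add_of_le (Finsupp.single_le_iff.2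
      (Nat.one_le_iff_ne_zero.2 (Finsupp.mem_support_iff.1 hi)))⟩
  obtain ⟨i, γ, rfl⟩ := step α (by rintro rfl; simp at hα)
  have hγ : γ.degree = 1 := by
    rw [map_add, Finsupp.degree_single] at hα
    omega
  obtain ⟨j, γ', rfl⟩ := step γ (by rintro rfl; simp at hγ)
  have hγ' : γ' = 0 := by
    rw [map_add, Finsupp.degree_single] at hγ
    exact (Finsupp.degree_eq_zero_iff γ').1 (by omega)
  exact ⟨i, j, by rw [hγ', add_zero]⟩

/-- The coefficient of `x i * x j`. -/
noncomputable def coeffPair (h : MvPolynomial σ ℝ) (i j : σ) : ℝ :=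
  coeff (Finsupp.single i 1 + Finsupp.single j 1) h

theorem coeffPair_comm (h : MvPolynomial σ ℝ) (i j : σ) : coeffPair h i j = coeffPair h j i := by
  rw [coeffPair, coeffPair, add_comm]

/-- The exponent of `x i * x j * x k`. -/
noncomputable def cubic (i j k : σ) : σ →₀ ℕ :=
  Finsupp.single i 1 + Finsupp.single j 1 + Finsupp.single k 1

variable [DecidableEq σ]

theorem le_sum_powerset_insert (c : Finset σ → ℕ) (k : σ) (U : Finset σ) :
    c {k} + ∑ l ∈ U, c {k, l} ≤ ∑ W ∈ U.powerset, c (insert k W) := by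
  have hinj : Set.InjOn (fun l : σ => ({l} : Finset σ)) U := singleton_injective.injOn
  have h0 : (∅ : Finset σ) ∉ U.image fun l => {l} := by simp
  calc c {k} + ∑ l ∈ U, c {k, l}
      = ∑ W ∈ insert ∅ (U.image fun l => {l}), c (insert k W) := by
        rw [sum_insert h0, sum_image hinj]
        rfl
    _ ≤ _ := by
        refine sum_le_sum_of_subset fun W hW => ?_
        rcases mem_insert.1 hW with rfl | hW
        · exact empty_mem_powerset U
        · obtain ⟨l, hl, rfl⟩ := mem_image.1 hW
          simpa using hl

/-- A weight on the subsets of `V` is large in total if it is positive on all pairs outside a graph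
`N`, and every edge of `N` forms with each further vertex a heavy pair. -/
theorem card_sq_le_sum_powerset (c : Finset σ → ℕ) (N : σ → σ → Prop) (h0 : 2 ≤ c ∅)
    (V : Finset σ) (h1 : ∀ k ∈ V, 3 ≤ c {k})
    (h2 : ∀ k ∈ V, ∀ l ∈ V, k ≠ l → ¬ N k l → 1 ≤ c {k, l})
    (h3 : ∀ k ∈ V, ∀ l ∈ V, k ≠ l → N k l → ∀ m ∈ V, m ≠ k → m ≠ l →
      3 ≤ c {k, m} ∨ 3 ≤ c {l, m}) :
    V.card ^ 2 + 5 * V.card + 2 ≤ 2 * ∑ W ∈ V.powerset, c W := by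
  induction V using Finset.strongInduction with
  | H V ih =>
  have ih' : ∀ U ⊂ V, U.card ^ 2 + 5 * U.card + 2 ≤ 2 * ∑ W ∈ U.powerset, c W := by
    intro U hU
    have hs := hU.subset
    exact ih U hU (fun k hk => h1 k (hs hk)) (fun k hk l hl => h2 k (hs hk) l (hs hl))
      fun k hk l hl hkl hN m hm => h3 k (hs hk) l (hs hl) hkl hN m (hs hm)
  by_cases hN : ∃ k ∈ V, ∃ l ∈ V, k ≠ l ∧ N k l
  · obtain ⟨k, hk, l, hl, hkl, hN⟩ := hN
    set U := (V.erase k).erase l with hU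
    have hl' : l ∈ V.erase k := mem_erase.2 ⟨hkl.symm, hl⟩
    have hV : V = insert k (insert l U) := by rw [hU, insert_erase hl', insert_erase hk]
    have hkU : k ∉ insert l U := by simp [hkl, hU]
    have hlU : l ∉ U := by simp [hU]
    have hcard : V.card = U.card + 2 := by
      rw [hV, card_insert_of_notMem hkU, card_insert_of_notMem hlU]
    have hU' := ih' U (by rw [hU]; exact (erase_ssubset hl').trans (erase_ssubset hk))
    have e1 := le_sum_powerset_insert c k U
    have e2 := le_sum_powerset_insert c l U
    have e3 : ∑ _m ∈ U, 3 ≤ ∑ m ∈ U, c {k, m} + ∑ m ∈ U, c {l, m} := by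
      rw [← sum_add_distrib]
      refine sum_le_sum fun m hm => ?_
      obtain ⟨hml, hmk, hmV⟩ : m ≠ l ∧ m ≠ k ∧ m ∈ V := by simpa [hU] using hm
      have := h3 k hk l hl hkl hN m hmV hmk hml
      omega
    rw [sum_const, smul_eq_mul] at e3
    have e4 : ∑ W ∈ V.powerset, c W = ∑ W ∈ U.powerset, c W + ∑ W ∈ U.powerset, c (insert l W) +
        (∑ W ∈ U.powerset, c (insert k W) + ∑ W ∈ U.powerset, c (insert k (insert l W))) := by
      rw [hV, sum_powerset_insert hkU, sum_powerset_insert hlU, sum_powerset_insert hlU]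
    have e5 := h1 k hk
    have e6 := h1 l hl
    have e7 : 0 ≤ ∑ W ∈ U.powerset, c (insert k (insert l W)) := Nat.zero_le _
    have e8 : c ∅ ≤ ∑ W ∈ U.powerset, c W :=
      single_le_sum (f := c) (fun _ _ => Nat.zero_le _) (empty_mem_powerset U)
    have e9 : (U.card + 2) ^ 2 = U.card ^ 2 + 4 * U.card + 4 := by ring
    rw [hcard, e4, e9]
    -- With `u = U.card`, removing the edge must account for `2u + 7`, and `6 + 3u` is available.
    -- This is one short when `u = 0`, where `c ∅ ≥ 2` and the two singletons give the required
    -- total 8 directly.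
    rcases Nat.eq_zero_or_pos U.card with hU0 | hU0
    · rw [hU0] at e3 ⊢
      omega
    · omega
  · push Not at hN
    rcases V.eq_empty_or_nonempty with rfl | ⟨k, hk⟩
    · simp; omega
    · have hU' := ih' _ (erase_ssubset hk)
      have hcard := card_erase_add_one hk
      have e1 := le_sum_powerset_insert c k (V.erase k)
      have e3 : ∑ _m ∈ V.erase k, 1 ≤ ∑ m ∈ V.erase k, c {k, m} := by
        refine sum_le_sum fun m hm => ?_
        have hm' := mem_erase.1 hm
        exact h2 k hk m hm'.2 hm'.1.symm (hN k hk m hm'.2 hm'.1.symm)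
      rw [sum_const, smul_eq_mul, mul_one] at e3
      have e4 : ∑ W ∈ V.powerset, c W = ∑ W ∈ (V.erase k).powerset, c W +
          ∑ W ∈ (V.erase k).powerset, c (insert k W) := by
        conv_lhs => rw [← insert_erase hk, sum_powerset_insert (notMem_erase k V)]
      have e5 := h1 k hk
      have e9 : ((V.erase k).card + 1) ^ 2 = (V.erase k).card ^ 2 + 2 * (V.erase k).card + 1 := by
        ring
      rw [← hcard, e4, e9]
      omega

theorem sdiff_pair_eq {p q k l : σ} (hk : k ≠ p ∧ k ≠ q) (hl : l ≠ p ∧ l ≠ q) :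
    ({k, k, l} : Finset σ) \ {p, q} = {k, l} ∧ ({l, l, k} : Finset σ) \ {p, q} = {k, l} ∧
      ({p, k, l} : Finset σ) \ {p, q} = {k, l} ∧ ({q, k, l} : Finset σ) \ {p, q} = {k, l} := by
  refine ⟨?_, ?_, ?_, ?_⟩ <;> grind

theorem sdiff_pair_eq_singleton {p q k : σ} (hk : k ≠ p ∧ k ≠ q) :
    ({p, p, k} : Finset σ) \ {p, q} = {k} ∧ ({q, q, k} : Finset σ) \ {p, q} = {k} ∧
      ({k, k, p} : Finset σ) \ {p, q} = {k} ∧ ({k, k, q} : Finset σ) \ {p, q} = {k} ∧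
      ({k, k, k} : Finset σ) \ {p, q} = {k} := by
  refine ⟨?_, ?_, ?_, ?_, ?_⟩ <;> grind

theorem cubic_support (i j k : σ) : (cubic i j k).support = {i, j, k} := by
  ext x
  simp [cubic, Finsupp.single_apply]
  grind

section

variable {I : Finset σ} (h : MvPolynomial σ ℝ)

theorem coeff_cubic_self {i : σ} (hi : i ∈ I) :
    coeff (cubic i i i) (linSum ℝ I * h) = coeffPair h i i := by
  rw [cubic, coeffPair, ← Finsupp.single_add, ← Finsupp.single_add]
  exact coeff_linSum_mul_add_single_self h hi 2

theorem coeff_cubic_pair {i j : σ} (hi : i ∈ I) (hj : j ∈ I) (hij : i ≠ j) :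
    coeff (cubic i i j) (linSum ℝ I * h) = coeffPair h i i + coeffPair h i j := by
  rw [cubic, coeff_linSum_mul_add_single h _ hj, sum_eq_single i]
  · rw [if_neg (by simp)]
    simp only [coeffPair]
    congr 2
    rw [add_assoc, add_tsub_cancel_left]
  · intro l _ hl
    rw [if_pos (by simp [hl])]
  · intro hn
    exact absurd (mem_erase.2 ⟨hij, hi⟩) hn

theorem coeff_cubic {i j k : σ} (hi : i ∈ I) (hj : j ∈ I) (hk : k ∈ I) (hij : i ≠ j)
    (hik : i ≠ k) (hjk : j ≠ k) :
    coeff (cubic i j k) (linSum ℝ I * h) =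
      coeffPair h i j + coeffPair h i k + coeffPair h j k := by
  have hsub : {i, j} ⊆ I.erase k := by
    simp [insert_subset_iff, hi, hj, hik, hjk]
  rw [cubic, coeff_linSum_mul_add_single h _ hk, ← sum_subset hsub, sum_pair hij,
    if_neg (by simp), if_neg (by simp)]
  · simp only [coeffPair]
    rw [add_assoc, add_tsub_cancel_left,
      add_comm (Finsupp.single i 1) (Finsupp.single j 1 + Finsupp.single k 1),
      add_right_comm (Finsupp.single j 1), add_assoc (Finsupp.single j 1), add_tsub_cancel_left]
    ring
  · intro l _ hl
    rw [if_pos]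
    simp only [mem_insert, mem_singleton, not_or] at hl
    simp [hl.1, hl.2]

end

/-- Squares have nonnegative coefficients, as the cubes in `g` show, so the negative coefficient is
some `a p q` with `p ≠ q`. The graph for `card_sq_le_sum_powerset` joins `k` and `l` when `a k l <
0`; then `a k m + a l m > 0` for every further `m`, so one of these is positive and its pair is
heavy. The resulting bound is `(m² + m) / 2 - 2`. -/
theorem IsCritical.card_sq_add_card_le {I : Finset σ} {h : MvPolynomial σ ℝ}
    (hc : IsCritical I 2 h) :
    I.card ^ 2 + I.card ≤ 2 * (linSum ℝ I * h).support.card + 4 := by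
  set a := coeffPair h with ha
  set g := linSum ℝ I * h with hg
  have hcomm : ∀ i j, a i j = a j i := coeffPair_comm h
  have g3 : ∀ i ∈ I, coeff (cubic i i i) g = a i i := fun i hi => coeff_cubic_self h hi
  have g21 : ∀ i ∈ I, ∀ j ∈ I, i ≠ j → coeff (cubic i i j) g = a i i + a i j :=
    fun i hi j hj hij => coeff_cubic_pair h hi hj hij
  have g111 : ∀ i ∈ I, ∀ j ∈ I, ∀ k ∈ I, i ≠ j → i ≠ k → j ≠ k →
      coeff (cubic i j k) g = a i j + a i k + a j k :=
    fun i hi j hj k hk => coeff_cubic h hi hj hk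
  have p3 : ∀ i ∈ I, 0 ≤ a i i := fun i hi => g3 i hi ▸ hc.coeff_nonneg _
  have p21 : ∀ i ∈ I, ∀ j ∈ I, i ≠ j → 0 ≤ a i i + a i j :=
    fun i hi j hj hij => g21 i hi j hj hij ▸ hc.coeff_nonneg _
  have p111 : ∀ i ∈ I, ∀ j ∈ I, ∀ k ∈ I, i ≠ j → i ≠ k → j ≠ k → 0 ≤ a i j + a i k + a j k :=
    fun i hi j hj k hk hij hik hjk => g111 i hi j hj k hk hij hik hjk ▸ hc.coeff_nonneg _
  obtain ⟨p, hp, q, hq, hpq, hneg⟩ : ∃ p ∈ I, ∃ q ∈ I, p ≠ q ∧ a p q < 0 := by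
    obtain ⟨α, hα⟩ := hc.exists_neg
    obtain ⟨p, q, rfl⟩ := eq_single_add_single_of_degree (hc.degree_eq hα.ne)
    have hpI : p ∈ I := hc.support_subset _ hα.ne (by simp)
    have hqI : q ∈ I := hc.support_subset _ hα.ne (by simp)
    refine ⟨p, hpI, q, hqI, ?_, hα⟩
    rintro rfl
    exact (p3 p hpI).not_gt hα
  -- The terms of `g` are counted by the set of variables they contain besides `p` and `q`.
  set c : Finset σ → ℕ := fun W => #{β ∈ g.support | β.support \ {p, q} = W} with hcdef
  have hmem : ∀ i j k W, 0 < coeff (cubic i j k) g → ({i, j, k} : Finset σ) \ {p, q} = W →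
      cubic i j k ∈ g.support.filter fun β => β.support \ {p, q} = W := by
    intro i j k W hpos hW
    rw [mem_filter, mem_support_iff, cubic_support]
    exact ⟨hpos.ne', hW⟩
  have hpp : 0 < a p p := by have := p21 p hp q hq hpq; linarith
  have hqq : 0 < a q q := by have := p21 q hq p hp hpq.symm; rw [hcomm q p] at this; linarith
  have hsum : ∑ W ∈ (I \ {p, q}).powerset, c W = g.support.card := by
    refine (card_eq_sum_card_fiberwise fun β hβ => ?_).symm
    simp only [mem_coe, mem_powerset]
    exact sdiff_subset_sdiff (hc.support_mul_subset (mem_support_iff.1 hβ)) subset_rfl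
  have hV : ∀ k ∈ I \ {p, q}, k ∈ I ∧ k ≠ p ∧ k ≠ q := by
    intro k hk
    simpa [not_or] using hk
  have hne : ∀ (β γ : σ →₀ ℕ) (i : σ), β i ≠ γ i → β ≠ γ := by
    rintro β γ i hi rfl
    exact hi rfl
  have hpk : ∀ k ∈ I \ {p, q}, 0 < a p k + a q k := by
    intro k hk
    obtain ⟨hkI, hkp, hkq⟩ := hV k hk
    have := p111 p hp q hq k hkI hpq hkp.symm hkq.symm
    linarith
  -- The two coefficients add up to `(a p k + a q k) + (a p l + a q l) + 2 * a k l > 0`.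
  have hpair : ∀ k ∈ I \ {p, q}, ∀ l ∈ I \ {p, q}, k ≠ l → 0 ≤ a k l →
      0 < coeff (cubic p k l) g ∨ 0 < coeff (cubic q k l) g := by
    intro k hk l hl hkl hpos
    obtain ⟨hkI, hkp, hkq⟩ := hV k hk
    obtain ⟨hlI, hlp, hlq⟩ := hV l hl
    rw [g111 p hp k hkI l hlI hkp.symm hlp.symm hkl, g111 q hq k hkI l hlI hkq.symm hlq.symm hkl]
    have e1 := hpk k hk
    have e2 := hpk l hl
    by_contra! hcon
    linarith [hcon.1, hcon.2]
  have hpos3 : ∀ k ∈ I \ {p, q}, ∀ l ∈ I \ {p, q}, k ≠ l → 0 < a k l → 3 ≤ c {k, l} := by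
    intro k hk l hl hkl hpos
    obtain ⟨hkI, hkp, hkq⟩ := hV k hk
    obtain ⟨hlI, hlp, hlq⟩ := hV l hl
    have m1 := hmem k k l {k, l} (by rw [g21 k hkI l hlI hkl]; linarith [p3 k hkI])
      (sdiff_pair_eq ⟨hkp, hkq⟩ ⟨hlp, hlq⟩).1
    have m2 := hmem l l k {k, l}
      (by rw [g21 l hlI k hkI hkl.symm, hcomm l k]; linarith [p3 l hlI])
      (sdiff_pair_eq ⟨hkp, hkq⟩ ⟨hlp, hlq⟩).2.1
    rcases hpair k hk l hl hkl hpos.le with h1 | h1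
    · have m3 := hmem p k l {k, l} h1 (sdiff_pair_eq ⟨hkp, hkq⟩ ⟨hlp, hlq⟩).2.2.1
      exact two_lt_card.2 ⟨_, m1, _, m2, _, m3, hne _ _ k (by simp [cubic, hkl]),
        hne _ _ k (by simp [cubic, hkl, hkp]), hne _ _ l (by simp [cubic, hkl, hlp])⟩
    · have m3 := hmem q k l {k, l} h1 (sdiff_pair_eq ⟨hkp, hkq⟩ ⟨hlp, hlq⟩).2.2.2
      exact two_lt_card.2 ⟨_, m1, _, m2, _, m3, hne _ _ k (by simp [cubic, hkl]),
        hne _ _ k (by simp [cubic, hkl, hkq]), hne _ _ l (by simp [cubic, hkl, hlq])⟩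
  have hmain := card_sq_le_sum_powerset c (fun k l => a k l < 0) ?_ (I \ {p, q}) ?_ ?_ ?_
  · rw [hsum] at hmain
    have hcard : (I \ {p, q}).card + 2 = I.card := by
      rw [card_sdiff_of_subset (by simp [insert_subset_iff, hp, hq]), card_pair hpq]
      have : ({p, q} : Finset σ).card ≤ I.card :=
        card_le_card (by simp [insert_subset_iff, hp, hq])
      rw [card_pair hpq] at this
      omega
    rw [← hcard]
    nlinarith
  · have m1 := hmem p p p ∅ (by rwa [g3 p hp]) (by simp)
    have m2 := hmem q q q ∅ (by rwa [g3 q hq]) (by simp)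
    exact one_lt_card.2 ⟨_, m1, _, m2, hne _ _ p (by simp [cubic, hpq])⟩
  · intro k hk
    obtain ⟨hkI, hkp, hkq⟩ := hV k hk
    have hs := sdiff_pair_eq_singleton ⟨hkp, hkq⟩
    have e1 := hpk k hk
    have e2 := p21 p hp k hkI hkp.symm
    have e3 := p21 q hq k hkI hkq.symm
    have e4 := p21 k hkI p hp hkp
    have e5 := p21 k hkI q hq hkq
    have e6 := p3 k hkI
    rw [hcomm k p] at e4
    rw [hcomm k q] at e5
    have t1 : 0 < a p p + a p k → cubic p p k ∈ g.support.filter fun β => β.support \ {p, q} = {k} :=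
      fun hh => hmem p p k {k} (by rwa [g21 p hp k hkI hkp.symm]) hs.1
    have t2 : 0 < a q q + a q k → cubic q q k ∈ g.support.filter fun β => β.support \ {p, q} = {k} :=
      fun hh => hmem q q k {k} (by rwa [g21 q hq k hkI hkq.symm]) hs.2.1
    have t3 : 0 < a k k + a p k → cubic k k p ∈ g.support.filter fun β => β.support \ {p, q} = {k} :=
      fun hh => hmem k k p {k} (by rwa [g21 k hkI p hp hkp, hcomm k p]) hs.2.2.1
    have t4 : 0 < a k k + a q k → cubic k k q ∈ g.support.filter fun β => β.support \ {p, q} = {k} :=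
      fun hh => hmem k k q {k} (by rwa [g21 k hkI q hq hkq, hcomm k q]) hs.2.2.2.1
    have t5 : 0 < a k k → cubic k k k ∈ g.support.filter fun β => β.support \ {p, q} = {k} :=
      fun hh => hmem k k k {k} (by rwa [g3 k hkI]) hs.2.2.2.2
    -- If `p p k` is missing, then `a p k = -a p p < 0`, which forces `a k k > 0` and `a q k > 0`;
    -- similarly with `p` and `q` exchanged. If both `p p k` and `q q k` occur, one of `a p k`, `a q
    -- k` is positive and gives the third term.
    by_cases c1 : 0 < a p p + a p k
    · by_cases c2 : 0 < a q q + a q k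
      · by_cases c3 : 0 < a p k
        · exact two_lt_card.2 ⟨_, t1 c1, _, t2 c2, _, t3 (by linarith),
            hne _ _ p (by simp [cubic, hpq, hkp]), hne _ _ k (by simp [cubic, hkp]),
            hne _ _ k (by simp [cubic, hkp, hkq])⟩
        · exact two_lt_card.2 ⟨_, t1 c1, _, t2 c2, _, t4 (by linarith),
            hne _ _ p (by simp [cubic, hpq, hkp]), hne _ _ k (by simp [cubic, hkp, hkq]),
            hne _ _ k (by simp [cubic, hkq])⟩
      · exact two_lt_card.2 ⟨_, t1 c1, _, t3 (by linarith), _, t5 (by linarith),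
          hne _ _ k (by simp [cubic, hkp]), hne _ _ k (by simp [cubic, hkp]),
          hne _ _ k (by simp [cubic, hkp])⟩
    · exact two_lt_card.2 ⟨_, t2 (by linarith), _, t4 (by linarith), _, t5 (by linarith),
        hne _ _ k (by simp [cubic, hkq]), hne _ _ k (by simp [cubic, hkq]),
        hne _ _ k (by simp [cubic, hkq])⟩
  · intro k hk l hl hkl hN
    obtain ⟨hkI, hkp, hkq⟩ := hV k hk
    obtain ⟨hlI, hlp, hlq⟩ := hV l hl
    rw [Nat.one_le_iff_ne_zero, ← Nat.pos_iff_ne_zero, card_pos]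
    rcases hpair k hk l hl hkl (not_lt.1 hN) with h1 | h1
    · exact ⟨_, hmem p k l {k, l} h1 (sdiff_pair_eq ⟨hkp, hkq⟩ ⟨hlp, hlq⟩).2.2.1⟩
    · exact ⟨_, hmem q k l {k, l} h1 (sdiff_pair_eq ⟨hkp, hkq⟩ ⟨hlp, hlq⟩).2.2.2⟩
  · intro k hk l hl hkl hN m hm hmk hml
    have := p111 k (hV k hk).1 l (hV l hl).1 m (hV m hm).1 hkl hmk.symm hml.symm
    by_cases hpos : 0 < a k m
    · exact Or.inl (hpos3 k hk m hm hmk.symm hpos)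
    · exact Or.inr (hpos3 l hl m hm hml.symm (by linarith))

end HermSOS

/-! ### From Hermitian forms with diagonal matrix to real forms, and the prolongation matrix. -/

namespace HermSOS

open MvPolynomial Finset

variable {n d : ℕ}

theorem mem_multiIdx_iff {α : Fin n →₀ ℕ} :
    α ∈ finsuppAntidiag (univ : Finset (Fin n)) d ↔ α.degree = d := by
  rw [mem_finsuppAntidiag, Finsupp.degree_eq_sum]
  simp

theorem exists_eq_sumElim (m : Fin n ⊕ Fin n →₀ ℕ) : ∃ α β, m = Finsupp.sumElim α β :=
  ⟨m.comapDomain Sum.inl Sum.inl_injective.injOn, m.comapDomain Sum.inr Sum.inr_injective.injOn,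
    by ext (i | i) <;> simp⟩

theorem sumElim_inj {α β α' β' : Fin n →₀ ℕ} :
    Finsupp.sumElim α β = Finsupp.sumElim α' β' ↔ α = α' ∧ β = β' := by
  refine ⟨fun h => ⟨?_, ?_⟩, by rintro ⟨rfl, rfl⟩; rfl⟩
  · ext i
    simpa using DFunLike.congr_fun h (Sum.inl i)
  · ext i
    simpa using DFunLike.congr_fun h (Sum.inr i)

theorem coeff_rename_mul_rename (p q : MvPolynomial (Fin n) ℂ) (α β : Fin n →₀ ℕ) :
    coeff (Finsupp.sumElim α β) (rename Sum.inl p * rename Sum.inr q : MixedPoly n) =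
      coeff α p * coeff β q := by
  induction p using MvPolynomial.induction_on' with
  | add p p' hp hp' => rw [map_add, add_mul, coeff_add, hp, hp', coeff_add, add_mul]
  | monomial u a =>
    induction q using MvPolynomial.induction_on' with
    | add q q' hq hq' => rw [map_add, mul_add, coeff_add, hq, hq', coeff_add, mul_add]
    | monomial v b =>
      rw [rename_monomial, rename_monomial, monomial_mul, ← Finsupp.sumElim_eq_add, coeff_monomial,
        coeff_monomial, coeff_monomial]
      by_cases hu : u = α <;> by_cases hv : v = β <;> simp [sumElim_inj, hu, hv]

theorem conj_eval {τ : Type*} (w : τ → ℂ) (p : MvPolynomial τ ℂ) :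
    (starRingEnd ℂ) (eval w p) = eval₂ (starRingEnd ℂ) ((starRingEnd ℂ) ∘ w) p := by
  rw [eval, coe_eval₂Hom, eval₂_comp_left (starRingEnd ℂ)]
  rfl

/-- A polynomial in `z` and `z̄` is determined by its values. -/
theorem eq_of_value_eq {A B : MixedPoly n} (h : ∀ z, value A z = value B z) : A = B := by
  -- Substituting `z = u + i v`, `z̄ = u - i v` turns values of `A` into values of `φ A` at real
  -- points, which determine `φ A`. The substitution is invertible over `ℂ`.
  let φ : MixedPoly n →ₐ[ℂ] MixedPoly n := aeval (Sum.elim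
    (fun i => X (Sum.inl i) + C Complex.I * X (Sum.inr i))
    (fun i => X (Sum.inl i) - C Complex.I * X (Sum.inr i)))
  have heval : ∀ (P : MixedPoly n) (w : Fin n ⊕ Fin n → ℂ), eval w (φ P) =
      eval (Sum.elim (fun i => w (Sum.inl i) + Complex.I * w (Sum.inr i))
        (fun i => w (Sum.inl i) - Complex.I * w (Sum.inr i))) P := by
    intro P w
    induction P using MvPolynomial.induction_on with
    | C a => simp [φ]
    | add p q hp hq => rw [map_add, map_add, hp, hq, map_add]
    | mul_X p i hp =>
      rw [map_mul, map_mul, hp, map_mul]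
      rcases i with i | i <;> simp [φ]
  have hφ : φ A = φ B := by
    refine funext_set (fun _ => Set.range ((↑) : ℝ → ℂ))
      (fun _ => Set.infinite_range_of_injective Complex.ofReal_injective) fun w hw => ?_
    choose t ht using fun i => hw i (Set.mem_univ i)
    rw [heval, heval]
    have := h fun i => w (Sum.inl i) + Complex.I * w (Sum.inr i)
    simp only [value] at this
    convert this using 3 <;>
    · congr 1
      funext i
      rw [← ht, ← ht, map_add, map_mul, Complex.conj_I, Complex.conj_ofReal, Complex.conj_ofReal]
      ring
  refine MvPolynomial.funext fun w => ?_
  have hw : w = Sum.elim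
      (fun i => (w (Sum.inl i) + w (Sum.inr i)) / 2 +
        Complex.I * (-Complex.I * (w (Sum.inl i) - w (Sum.inr i)) / 2))
      (fun i => (w (Sum.inl i) + w (Sum.inr i)) / 2 -
        Complex.I * (-Complex.I * (w (Sum.inl i) - w (Sum.inr i)) / 2)) := by
    have hI := Complex.I_mul_I
    funext i
    rcases i with i | i
    · simp only [Sum.elim_inl]
      linear_combination (w (Sum.inl i) - w (Sum.inr i)) / 2 * hI
    · simp only [Sum.elim_inr]
      linear_combination -(w (Sum.inl i) - w (Sum.inr i)) / 2 * hI
  have e1 := heval A (Sum.elim (fun i => (w (Sum.inl i) + w (Sum.inr i)) / 2)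
    fun i => -Complex.I * (w (Sum.inl i) - w (Sum.inr i)) / 2)
  have e2 := heval B (Sum.elim (fun i => (w (Sum.inl i) + w (Sum.inr i)) / 2)
    fun i => -Complex.I * (w (Sum.inl i) - w (Sum.inr i)) / 2)
  simp only [Sum.elim_inl, Sum.elim_inr] at e1 e2
  rw [← hw] at e1 e2
  rw [← e1, ← e2, hφ]

/-- The substitution `x i ↦ z i * z̄ i`. -/
noncomputable def diagHom (n : ℕ) : MvPolynomial (Fin n) ℝ →+* MixedPoly n :=
  eval₂Hom (C.comp Complex.ofRealHom) fun i => X (Sum.inl i) * X (Sum.inr i)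

theorem diagHom_linSum : diagHom n (linSum ℝ univ) = normSq n := by
  simp [diagHom, linSum, normSq]

theorem diagHom_monomial (α : Fin n →₀ ℕ) (c : ℝ) :
    diagHom n (monomial α c) = monomial (Finsupp.sumElim α α) (c : ℂ) := by
  rw [diagHom, coe_eval₂Hom, eval₂_monomial, monomial_eq, Finsupp.prod_sumElim]
  simp only [mul_pow, Finsupp.prod_mul]
  rfl

theorem coeff_diagHom (h : MvPolynomial (Fin n) ℝ) (α β : Fin n →₀ ℕ) :
    coeff (Finsupp.sumElim α β) (diagHom n h) = if α = β then ((coeff α h : ℝ) : ℂ) else 0 := by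
  induction h using MvPolynomial.induction_on' with
  | add p q hp hq => rw [map_add, coeff_add, hp, hq, coeff_add]; split_ifs <;> simp
  | monomial u a =>
    rw [diagHom_monomial, coeff_monomial, coeff_monomial]
    by_cases hαβ : α = β
    · subst hαβ
      by_cases hα : u = α <;> simp [sumElim_inj, hα]
    · rw [if_neg hαβ, if_neg]
      rw [sumElim_inj]
      rintro ⟨rfl, rfl⟩
      exact hαβ rfl

theorem value_diagHom (h : MvPolynomial (Fin n) ℝ) (z : Fin n → ℂ) :
    value (diagHom n h) z = ((eval (fun i => ‖z i‖ ^ 2) h : ℝ) : ℂ) := by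
  induction h using MvPolynomial.induction_on with
  | C a => simp [value, diagHom]
  | add p q hp hq =>
    simp only [value] at hp hq ⊢
    rw [map_add, map_add, hp, hq, map_add, Complex.ofReal_add]
  | mul_X p i hp =>
    simp only [value] at hp ⊢
    rw [map_mul, map_mul, hp, map_mul, Complex.ofReal_mul]
    simp [diagHom, Complex.mul_conj, Complex.normSq_eq_norm_sq]

theorem diagHom_mem_forms {h : MvPolynomial (Fin n) ℝ} (hd : h.IsHomogeneous d) :
    diagHom n h ∈ forms n d := by
  refine ⟨fun z => by rw [value_diagHom, Complex.ofReal_im], fun m hm => ?_⟩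
  obtain ⟨α, β, rfl⟩ := exists_eq_sumElim m
  rw [mem_support_iff, coeff_diagHom] at hm
  split_ifs at hm with hαβ
  · subst hαβ
    have hα : coeff α h ≠ 0 := by simpa using hm
    have : α.degree = d := by
      by_contra hne
      exact hα (hd.coeff_eq_zero hne)
    rw [Finsupp.degree_eq_sum] at this
    simpa using this
  · exact absurd rfl hm

theorem coeffMatrix_diagHom (h : MvPolynomial (Fin n) ℝ) :
    coeffMatrix d (diagHom n h) = Matrix.diagonal fun α => ((coeff α.1 h : ℝ) : ℂ) := by
  ext α β
  rw [coeffMatrix, Matrix.of_apply, coeff_diagHom, Matrix.diagonal_apply]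
  simp only [Subtype.ext_iff]

theorem card_coeff_ne_zero {h : MvPolynomial (Fin n) ℝ} (hd : h.IsHomogeneous d) :
    {α : MultiIdx n d | coeff α.1 h ≠ 0}.ncard = h.support.card := by
  rw [← Set.ncard_coe_finset, ← Set.ncard_image_of_injective _ Subtype.val_injective]
  congr 1
  ext α
  simp only [Set.mem_image, Set.mem_ofPred_eq, mem_coe, mem_support_iff]
  constructor
  · rintro ⟨α, hα, rfl⟩
    exact hα
  · intro hα
    refine ⟨⟨α, mem_multiIdx_iff.2 ?_⟩, hα, rfl⟩
    by_contra hne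
    exact hα (hd.coeff_eq_zero hne)

theorem formRank_diagHom {h : MvPolynomial (Fin n) ℝ} (hd : h.IsHomogeneous d) :
    formRank d (diagHom n h) = h.support.card := by
  classical
  rw [formRank, coeffMatrix_diagHom, Matrix.rank_diagonal, ← card_coeff_ne_zero hd,
    ← Nat.card_eq_fintype_card]
  simp only [ne_eq, Complex.ofReal_eq_zero]
  rfl

/-- In `∑ ‖f k‖²` the coefficient of `z^α z̄^α` is the sum of the squared moduli of the coefficients
of `z^α` in the `f k`. Conversely, the monomials `√(coeff α h) * z^α` give a sum of squares. -/
theorem diagHom_mem_sos {h : MvPolynomial (Fin n) ℝ} :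
    diagHom n h ∈ sos n ↔ ∀ α, 0 ≤ coeff α h := by
  constructor
  · rintro ⟨R, f, hf⟩ α
    have heq : diagHom n h = ∑ k, rename Sum.inl (f k) *
        rename Sum.inr (map (starRingEnd ℂ) (f k)) := by
      refine eq_of_value_eq fun z => ?_
      rw [hf, value, map_sum, Complex.ofReal_sum]
      refine sum_congr rfl fun k _ => ?_
      rw [map_mul, eval_rename, eval_rename, Sum.elim_comp_inl, Sum.elim_comp_inr, eval_map]
      have := conj_eval z (f k)
      rw [Function.comp_def] at this
      rw [← this, Complex.mul_conj, Complex.normSq_eq_norm_sq]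
    have hc := coeff_diagHom h α α
    rw [if_pos rfl, heq, coeff_sum] at hc
    have hre := congrArg Complex.re hc
    rw [Complex.ofReal_re, Complex.re_sum] at hre
    rw [← hre]
    refine sum_nonneg fun k _ => ?_
    rw [coeff_rename_mul_rename, coeff_map, Complex.mul_conj, Complex.ofReal_re]
    exact Complex.normSq_nonneg _
  · intro hpos
    refine ⟨h.support.card, fun k => monomial (h.support.equivFin.symm k).1
      ((Real.sqrt (coeff (h.support.equivFin.symm k).1 h) : ℝ) : ℂ), fun z => ?_⟩
    rw [value_diagHom]
    congr 1
    rw [← h.support.equivFin.sum_comp, eval_eq, ← sum_coe_sort]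
    refine sum_congr rfl fun α _ => ?_
    dsimp only
    rw [Equiv.symm_apply_apply, eval_monomial, norm_mul, mul_pow, Complex.norm_real,
      Real.norm_eq_abs, sq_abs, Real.sq_sqrt (hpos _), Finsupp.prod, norm_prod, ← prod_pow]
    congr 1
    refine prod_congr rfl fun i _ => ?_
    rw [norm_pow, ← pow_mul, ← pow_mul, mul_comm]

theorem exists_eq_diagHom {A : MixedPoly n} (hA : A ∈ forms n d)
    (hdiag : (coeffMatrix d A).IsDiag) :
    ∃ h : MvPolynomial (Fin n) ℝ, h.IsHomogeneous d ∧ A = diagHom n h := by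
  obtain ⟨hreal, hbi⟩ := hA
  have hdeg : ∀ α β, coeff (Finsupp.sumElim α β) A ≠ 0 → α.degree = d ∧ β.degree = d := by
    intro α β hne
    have := hbi _ (mem_support_iff.2 hne)
    rw [Finsupp.degree_eq_sum, Finsupp.degree_eq_sum]
    simpa using this
  -- Real values make the matrix Hermitian, so its diagonal entries are real.
  have hconj : rename Sum.swap (map (starRingEnd ℂ) A) = A := by
    refine eq_of_value_eq fun z => ?_
    rw [value, eval_rename, eval_map]
    have h1 : (Sum.elim z fun i => (starRingEnd ℂ) (z i)) ∘ Sum.swap =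
        (starRingEnd ℂ) ∘ (Sum.elim z fun i => (starRingEnd ℂ) (z i)) := by
      funext i
      rcases i with i | i <;> simp
    have h2 : (starRingEnd ℂ) (value A z) = value A z := Complex.conj_eq_iff_im.2 (hreal z)
    rw [h1, ← conj_eval]
    exact h2
  have him : ∀ α, ((coeff (Finsupp.sumElim α α) A).re : ℂ) = coeff (Finsupp.sumElim α α) A := by
    intro α
    rw [← Complex.conj_eq_iff_re, ← coeff_map]
    conv_rhs => rw [← hconj, ← Finsupp.mapDomain_swap_sumElim,
      coeff_rename_mapDomain _ Sum.swap_leftInverse.injective]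
  refine ⟨∑ α ∈ finsuppAntidiag univ d, monomial α (coeff (Finsupp.sumElim α α) A).re,
    IsHomogeneous.sum _ _ _ fun α hα => isHomogeneous_monomial _ (mem_multiIdx_iff.1 hα), ?_⟩
  ext m
  obtain ⟨α, β, rfl⟩ := exists_eq_sumElim m
  rw [coeff_diagHom]
  split_ifs with hαβ
  · subst hαβ
    rw [coeff_sum]
    simp only [coeff_monomial, sum_ite_eq']
    split_ifs with hα
    · exact (him α).symm
    · by_contra hne
      exact hα (mem_multiIdx_iff.2 (hdeg α α (by simpa using hne)).1)
  · by_contra hne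
    obtain ⟨h1, h2⟩ := hdeg α β hne
    exact hne (hdiag (i := ⟨α, mem_multiIdx_iff.2 h1⟩) (j := ⟨β, mem_multiIdx_iff.2 h2⟩)
      fun h' => hαβ (congrArg Subtype.val h'))

theorem linSum_mul_isHomogeneous {h : MvPolynomial (Fin n) ℝ} (hd : h.IsHomogeneous d) :
    (linSum ℝ univ * h).IsHomogeneous (d + 1) := by
  rw [add_comm]
  exact (linSum_isHomogeneous univ).mul hd

/-- The number of terms of `h * (x 1 + ⋯ + x n)`, as `h` runs through the critical forms. -/
def termCounts (n d : ℕ) : Set ℕ :=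
  {r | ∃ h : MvPolynomial (Fin n) ℝ, IsCritical univ d h ∧ r = (linSum ℝ univ * h).support.card}

theorem diagHom_mul_normSq (h : MvPolynomial (Fin n) ℝ) :
    diagHom n h * normSq n = diagHom n (linSum ℝ univ * h) := by
  rw [map_mul, diagHom_linSum, mul_comm]

theorem diagHom_mem_criticalForms {h : MvPolynomial (Fin n) ℝ} (hd : h.IsHomogeneous d) :
    diagHom n h ∈ criticalForms n d ↔ IsCritical univ d h := by
  have hf := diagHom_mem_forms hd
  have hf' := diagHom_mem_forms (linSum_mul_isHomogeneous hd)
  simp only [criticalForms, sosForms, Set.mem_ofPred_eq, Set.mem_inter_iff, diagHom_mul_normSq,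
    hf, hf', and_true, true_and, diagHom_mem_sos, coeffMatrix_diagHom, Matrix.isDiag_diagonal,
    not_forall, not_le]
  exact ⟨fun ⟨h1, h2⟩ => ⟨hd, fun _ _ => subset_univ _, h2, h1⟩,
    fun hc => ⟨hc.exists_neg, hc.coeff_nonneg⟩⟩

theorem setOf_formRank_eq : {r | ∃ A ∈ criticalForms n d, r = formRank (d + 1) (A * normSq n)} =
    termCounts n d := by
  ext r
  constructor
  · rintro ⟨A, hA, rfl⟩
    obtain ⟨h, hd, rfl⟩ := exists_eq_diagHom hA.1 hA.2.1
    refine ⟨h, (diagHom_mem_criticalForms hd).1 hA, ?_⟩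
    rw [diagHom_mul_normSq, formRank_diagHom (linSum_mul_isHomogeneous hd)]
  · rintro ⟨h, hc, rfl⟩
    refine ⟨diagHom n h, (diagHom_mem_criticalForms hc.isHomogeneous).2 hc, ?_⟩
    rw [diagHom_mul_normSq, formRank_diagHom (linSum_mul_isHomogeneous hc.isHomogeneous)]

theorem prolongation_mulVec {h : MvPolynomial (Fin n) ℝ} (hd : h.IsHomogeneous d) :
    (prolongation n d).mulVec (fun α => coeff α.1 h) =
      fun β => coeff β.1 (linSum ℝ univ * h) := by
  have hh : h = ∑ α ∈ finsuppAntidiag univ d, monomial α (coeff α h) := by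
    ext α
    rw [coeff_sum]
    simp only [coeff_monomial, sum_ite_eq']
    split_ifs with hα
    · rfl
    · exact hd.coeff_eq_zero fun h' => hα (mem_multiIdx_iff.2 h')
  ext β
  conv_rhs => rw [hh, mul_sum, coeff_sum, ← sum_coe_sort]
  rw [Matrix.mulVec, dotProduct]
  refine sum_congr rfl fun α _ => ?_
  have : linSum ℝ univ * monomial α.1 (coeff α.1 h) =
      C (coeff α.1 h) * (monomial α.1 1 * ∑ i, X i) := by
    rw [← mul_assoc, C_mul_monomial, mul_one, mul_comm]
    rfl
  rw [this, coeff_C_mul, mul_comm]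
  rfl

theorem prolongedRanks_eq : prolongedRanks n d = termCounts n d := by
  have hrank : ∀ h : MvPolynomial (Fin n) ℝ, h.IsHomogeneous d →
      vecRank ((prolongation n d).mulVec fun α => coeff α.1 h) =
        (linSum ℝ univ * h).support.card := by
    intro h hd
    rw [prolongation_mulVec hd, vecRank, card_coeff_ne_zero (linSum_mul_isHomogeneous hd)]
  ext r
  constructor
  · rintro ⟨v, hv, hJ, rfl⟩
    obtain ⟨h, hd, rfl⟩ : ∃ h : MvPolynomial (Fin n) ℝ, h.IsHomogeneous d ∧
        v = fun α => coeff α.1 h := by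
      refine ⟨∑ α, monomial α.1 (v α),
        IsHomogeneous.sum _ _ _ fun α _ => isHomogeneous_monomial _ (mem_multiIdx_iff.1 α.2), ?_⟩
      funext α
      rw [coeff_sum]
      simp only [coeff_monomial, ← Subtype.ext_iff, sum_ite_eq', mem_univ, if_true]
    refine ⟨h, ⟨hd, fun _ _ => subset_univ _, fun β => ?_, ?_⟩, hrank h hd⟩
    · by_cases hβ : β.degree = d + 1
      · rw [prolongation_mulVec hd] at hJ
        exact hJ ⟨β, mem_multiIdx_iff.2 hβ⟩
      · rw [(linSum_mul_isHomogeneous hd).coeff_eq_zero hβ]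
    · simp only [Pi.le_def, not_forall, not_le] at hv
      obtain ⟨α, hα⟩ := hv
      exact ⟨α.1, hα⟩
  · rintro ⟨h, hc, rfl⟩
    refine ⟨fun α => coeff α.1 h, fun hle => ?_, ?_, (hrank h hc.isHomogeneous).symm⟩
    · obtain ⟨α, hα⟩ := hc.exists_neg
      exact (hle ⟨α, mem_multiIdx_iff.2 (hc.degree_eq hα.ne)⟩).not_gt hα
    · rw [prolongation_mulVec hc.isHomogeneous]
      exact fun β => hc.coeff_nonneg β.1

end HermSOS

/-! ### Sharp examples from sums of cubes, and the size of Ebenfelt's bound. -/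

namespace HermSOS

open MvPolynomial Finset

theorem coeff_linSum_pow_eq_zero {σ : Type*} [DecidableEq σ] {J : Finset σ} {i : σ} (hi : i ∉ J)
    (a : ℕ) {β : σ →₀ ℕ} (hβ : β i ≠ 0) : coeff β (linSum ℝ J ^ a) = 0 := by
  induction a generalizing β with
  | zero => rw [pow_zero, coeff_one, if_neg]; rintro rfl; exact hβ rfl
  | succ a ih =>
    rw [pow_succ', coeff_linSum_mul]
    refine sum_eq_zero fun j hj => ?_
    split_ifs with h0
    · rfl
    · have hji : j ≠ i := by rintro rfl; exact hi hj
      exact ih (by simpa [hji] using hβ)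

theorem card_support_linSum_pow_pair_le {σ : Type*} [DecidableEq σ] (i j : σ) (hij : i ≠ j)
    (a : ℕ) : (linSum ℝ {i, j} ^ a).support.card ≤ a + 1 := by
  have hsub : (linSum ℝ {i, j} ^ a).support ⊆
      (range (a + 1)).image fun t => Finsupp.single i t + Finsupp.single j (a - t) := by
    intro β hβ
    rw [mem_support_iff] at hβ
    have hJ : ∀ l, l ≠ i → l ≠ j → β l = 0 := by
      intro l h1 h2
      by_contra h0
      exact hβ (coeff_linSum_pow_eq_zero (by simp [h1, h2]) a h0)
    have hβe : β = Finsupp.single i (β i) + Finsupp.single j (β j) := by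
      ext l
      by_cases h1 : l = i
      · simp [h1, hij.symm]
      · by_cases h2 : l = j
        · simp [h2, hij]
        · simp [Ne.symm h1, Ne.symm h2, hJ l h1 h2]
    have hdeg : β.degree = a := by
      by_contra hne
      exact hβ (((linSum_isHomogeneous {i, j}).pow a).coeff_eq_zero (by rwa [one_mul]))
    have hsum : β i + β j = a := by
      rw [hβe, map_add, Finsupp.degree_single, Finsupp.degree_single] at hdeg
      exact hdeg
    refine mem_image.2 ⟨β i, mem_range.2 (by omega), ?_⟩
    rw [← hsum, add_tsub_cancel_left]
    exact hβe.symm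
  exact (card_le_card hsub).trans (card_image_le.trans (card_range _).le)

theorem card_support_linSum_pow_singleton_le {σ : Type*} (i : σ) (a : ℕ) :
    (linSum ℝ {i} ^ a).support.card ≤ 1 := by
  rw [linSum, sum_singleton, X_pow_eq_monomial]
  exact (card_le_card support_monomial_subset).trans (card_singleton _).le

section

variable {n : ℕ}

/-- `x i ^ (d - 2) * (u² - u v + v²)`, where `u` and `v` are the sums of the variables in `J` and
outside `J`. -/
noncomputable def sumOfCubesFactor (d : ℕ) (J : Finset (Fin n)) (i : Fin n) :
    MvPolynomial (Fin n) ℝ :=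
  monomial (Finsupp.single i (d - 2)) 1 *
    (linSum ℝ J ^ 2 - linSum ℝ J * linSum ℝ Jᶜ + linSum ℝ Jᶜ ^ 2)

theorem linSum_mul_sumOfCubesFactor (d : ℕ) (J : Finset (Fin n)) (i : Fin n) :
    linSum ℝ univ * sumOfCubesFactor d J i =
      monomial (Finsupp.single i (d - 2)) 1 * (linSum ℝ J ^ 3 + linSum ℝ Jᶜ ^ 3) := by
  have : linSum ℝ univ = linSum ℝ J + linSum ℝ Jᶜ := (sum_add_sum_compl J _).symm
  rw [this, sumOfCubesFactor]
  ring

theorem isCritical_sumOfCubesFactor {d : ℕ} (hd : 2 ≤ d) {J : Finset (Fin n)} {i j : Fin n}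
    (hi : i ∈ J) (hj : j ∉ J) : IsCritical univ d (sumOfCubesFactor d J i) where
  isHomogeneous := by
    have h1 := linSum_isHomogeneous J
    have h2 := linSum_isHomogeneous Jᶜ
    have := (isHomogeneous_monomial (1 : ℝ) (Finsupp.degree_single i (d - 2))).mul
      (((h1.pow 2).sub (h1.mul h2)).add (h2.pow 2))
    rwa [show d - 2 + 1 * 2 = d by omega] at this
  support_subset _ _ := subset_univ _
  coeff_nonneg β := by
    rw [linSum_mul_sumOfCubesFactor]
    refine monomial_mul_coeff_nonneg (fun γ => ?_) zero_le_one _ _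
    rw [coeff_add]
    exact add_nonneg (coeff_linSum_pow_nonneg _ _ _) (coeff_linSum_pow_nonneg _ _ _)
  exists_neg := by
    -- `x i * x j` occurs in `u v` with coefficient 1, but neither in `u²`, which lacks `x j`, nor
    -- in `v²`, which lacks `x i`.
    refine ⟨Finsupp.single i (d - 2) + (Finsupp.single j 1 + Finsupp.single i 1), ?_⟩
    rw [sumOfCubesFactor, coeff_monomial_mul, coeff_add, coeff_sub,
      coeff_linSum_pow_eq_zero hj 2 (by simp),
      coeff_linSum_pow_eq_zero (J := Jᶜ) (i := i) (by simp [hi]) 2 (by simp),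
      coeff_linSum_mul_add_single _ _ hi, sum_eq_zero]
    · have := coeff_linSum_pow_single (J := Jᶜ) (mem_compl.2 hj) 1
      rw [pow_one] at this
      rw [this]
      norm_num
    · intro k hk
      rw [if_pos]
      have : j ≠ k := by rintro rfl; exact hj (mem_erase.1 hk).2
      simp [this]

theorem card_support_sumOfCubesFactor_le (d : ℕ) (J : Finset (Fin n)) (i : Fin n) :
    (linSum ℝ univ * sumOfCubesFactor d J i).support.card ≤
      (linSum ℝ J ^ 3).support.card + (linSum ℝ Jᶜ ^ 3).support.card := by
  rw [linSum_mul_sumOfCubesFactor]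
  refine (card_le_card (support_mul _ _)).trans (card_add_le.trans ?_)
  have h1 : (monomial (Finsupp.single i (d - 2)) (1 : ℝ)).support.card ≤ 1 :=
    (card_le_card support_monomial_subset).trans (card_singleton _).le
  have h2 : (linSum ℝ J ^ 3 + linSum ℝ Jᶜ ^ 3).support.card ≤
      (linSum ℝ J ^ 3).support.card + (linSum ℝ Jᶜ ^ 3).support.card :=
    (card_le_card support_add).trans (card_union_le _ _)
  calc _ ≤ 1 * _ := Nat.mul_le_mul h1 h2
    _ = _ := one_mul _

theorem termCounts_nonempty {d : ℕ} (hn : 2 ≤ n) (hd : 2 ≤ d) : (termCounts n d).Nonempty := by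
  have hj : (⟨1, by omega⟩ : Fin n) ∉ ({⟨0, by omega⟩} : Finset (Fin n)) := by simp
  exact ⟨_, _, isCritical_sumOfCubesFactor hd (mem_singleton_self _) hj, rfl⟩

theorem three_mul_le_of_mem_termCounts {d r : ℕ} (hr : r ∈ termCounts n d) : 3 * n ≤ r + 4 := by
  obtain ⟨h, hc, rfl⟩ := hr
  simpa using hc.three_mul_card_le

theorem sq_add_le_of_mem_termCounts {r : ℕ} (hr : r ∈ termCounts n 2) :
    n ^ 2 + n ≤ 2 * r + 4 := by
  obtain ⟨h, hc, rfl⟩ := hr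
  simpa using hc.card_sq_add_card_le

theorem mem_termCounts_of_card_le {d r : ℕ} (hd : 2 ≤ d) {J : Finset (Fin n)} {i j : Fin n}
    (hi : i ∈ J) (hj : j ∉ J) (hr : r + 4 = 3 * n)
    (hcard : (linSum ℝ J ^ 3).support.card + (linSum ℝ Jᶜ ^ 3).support.card ≤ r) :
    r ∈ termCounts n d := by
  have hc := isCritical_sumOfCubesFactor hd hi hj
  refine ⟨_, hc, ?_⟩
  have h1 := card_support_sumOfCubesFactor_le d J i
  have h2 := three_mul_le_of_mem_termCounts ⟨_, hc, rfl⟩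
  omega

/-- The cube of a sum of one or two variables has 1 or 4 terms, so the splittings 1+1, 2+1, 2+2 cost
2, 5, 8, which is `3n - 4`; the lower bound turns these estimates into equalities. For five
variables the cheapest splitting 3+2 already costs 10+4, more than 11. -/
theorem exists_mem_termCounts {d : ℕ} (hn : 2 ≤ n) (hn4 : n ≤ 4) (hd : 2 ≤ d) :
    ∃ r ∈ termCounts n d, r + 4 = 3 * n := by
  interval_cases n
  · refine ⟨2, mem_termCounts_of_card_le hd (J := {0}) (i := 0) (j := 1) (by decide) (by decide)
      rfl ?_, rfl⟩
    rw [show ({0} : Finset (Fin 2))ᶜ = {1} by decide]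
    exact add_le_add (card_support_linSum_pow_singleton_le _ _)
      (card_support_linSum_pow_singleton_le _ _)
  · refine ⟨5, mem_termCounts_of_card_le hd (J := {0, 1}) (i := 0) (j := 2) (by decide) (by decide)
      rfl ?_, rfl⟩
    rw [show ({0, 1} : Finset (Fin 3))ᶜ = {2} by decide]
    exact add_le_add (card_support_linSum_pow_pair_le _ _ (by decide) _)
      (card_support_linSum_pow_singleton_le _ _)
  · refine ⟨8, mem_termCounts_of_card_le hd (J := {0, 1}) (i := 0) (j := 2) (by decide) (by decide)
      rfl ?_, rfl⟩
    rw [show ({0, 1} : Finset (Fin 4))ᶜ = {2, 3} by decide]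
    exact add_le_add (card_support_linSum_pow_pair_le _ _ (by decide) _)
      (card_support_linSum_pow_pair_le _ _ (by decide) _)

end

theorem ebenfeltBound_le (n : ℕ) (hn : 2 ≤ n) (hn6 : n ≤ 6) :
    ebenfeltBound n ≤ 3 * (n : ℝ) - 4 ∧ (ebenfeltBound n = 3 * (n : ℝ) - 4 ↔ n ≠ 3) := by
  have h2 : kappa 2 = 1 := by decide
  have h3 : kappa 3 = 1 := by decide
  have h4 : kappa 4 = 2 := by decide
  have h5 : kappa 5 = 2 := by decide
  have h6 : kappa 6 = 2 := by decide
  interval_cases n <;> norm_num [ebenfeltBound, h2, h3, h4, h5, h6]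

open Filter Asymptotics

theorem quadraticBound_isTheta :
    (fun n : ℕ => ((n : ℝ) ^ 2 + n) / 2 - 6) =Θ[atTop] fun n : ℕ => (n : ℝ) ^ 2 := by
  constructor
  · refine IsBigO.of_bound 1 ?_
    filter_upwards [eventually_ge_atTop 4] with n hn
    have hn' : (4 : ℝ) ≤ n := by exact_mod_cast hn
    rw [Real.norm_of_nonneg (by nlinarith), Real.norm_of_nonneg (by positivity)]
    nlinarith
  · refine IsBigO.of_bound 4 ?_
    filter_upwards [eventually_ge_atTop 6] with n hn
    have hn' : (6 : ℝ) ≤ n := by exact_mod_cast hn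
    rw [Real.norm_of_nonneg (by positivity), Real.norm_of_nonneg (by nlinarith)]
    nlinarith

/-- By maximality `κ (κ + 1) / 2 < n ≤ (κ + 1) (κ + 2) / 2`, so `κ` lies between `√n` and `2 √n` for
large `n`. The subtracted `κ (κ + 1) / 2` is below `n`, so the bound is comparable to `κ n`. The
threshold 64 only ensures `√n ≥ 8`, which is ample. -/
theorem ebenfeltBound_isTheta :
    ebenfeltBound =Θ[atTop] fun n : ℕ => (n : ℝ) ^ (3 / 2 : ℝ) := by
  have hpow : ∀ n : ℕ, 1 ≤ n → (n : ℝ) ^ (3 / 2 : ℝ) = n * √n := by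
    intro n hn
    have : (0 : ℝ) < n := by exact_mod_cast hn
    rw [show (3 / 2 : ℝ) = 1 + 1 / 2 by norm_num, Real.rpow_add this, Real.rpow_one,
      Real.sqrt_eq_rpow]
  have hbounds : ∀ n : ℕ, 64 ≤ n →
      (n : ℝ) * √n / 2 ≤ ebenfeltBound n ∧ ebenfeltBound n ≤ 3 * (n * √n) := by
    intro n hn
    have hn' : (64 : ℝ) ≤ n := by exact_mod_cast hn
    obtain ⟨h1, h2⟩ := kappa_isGreatest (n := n) (by omega)
    rw [Set.mem_ofPred_eq] at h1
    have h3 : (n : ℝ) ≤ ((kappa n : ℝ) + 1) * ((kappa n : ℝ) + 2) / 2 := by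
      by_contra! hlt
      have : kappa n + 1 ≤ kappa n := h2 (by
        rw [Set.mem_ofPred_eq]
        push_cast
        linarith)
      omega
    have hk0 : (0 : ℝ) ≤ kappa n := Nat.cast_nonneg _
    set κ : ℝ := (kappa n : ℝ) with hκ
    set r := √(n : ℝ) with hr
    have hr2 : r * r = n := Real.mul_self_sqrt (by positivity)
    have hr8 : 8 ≤ r := Real.le_sqrt_of_sq_le (by linarith)
    have hup : κ ≤ 2 * r := by nlinarith
    have hlow : r ≤ κ := by
      by_contra! hlt
      have : (κ + 1) * (κ + 2) ≤ (r + 1) * (r + 2) := by nlinarith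
      nlinarith
    rw [ebenfeltBound, ← hκ]
    constructor
    · nlinarith
    · nlinarith
  constructor
  · refine IsBigO.of_bound 3 ?_
    filter_upwards [eventually_ge_atTop 64] with n hn
    obtain ⟨h1, h2⟩ := hbounds n hn
    have h0 : (0 : ℝ) ≤ n * √n := by positivity
    rw [hpow n (by omega), Real.norm_of_nonneg (by linarith), Real.norm_of_nonneg h0]
    exact h2
  · refine IsBigO.of_bound 2 ?_
    filter_upwards [eventually_ge_atTop 64] with n hn
    obtain ⟨h1, h2⟩ := hbounds n hn
    have h0 : (0 : ℝ) ≤ n * √n := by positivity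
    rw [hpow n (by omega), Real.norm_of_nonneg h0, Real.norm_of_nonneg (by linarith)]
    linarith

end HermSOS

/-! ### Assembly of the theorem. -/

theorem theorem1p1 :
    -- (A): the bound, its comparison with Ebenfelt's bound, and its sharpness
    (∀ n d : ℕ, 2 ≤ n → 2 ≤ d → ∀ A ∈ HermSOS.criticalForms n d,
      3 * (n : ℝ) - 4 ≤ (HermSOS.formRank (d + 1) (A * HermSOS.normSq n) : ℝ)) ∧
    (∀ n : ℕ, 2 ≤ n → n ≤ 6 → HermSOS.ebenfeltBound n ≤ 3 * (n : ℝ) - 4 ∧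
      (HermSOS.ebenfeltBound n = 3 * (n : ℝ) - 4 ↔ n ≠ 3)) ∧
    (∀ n d : ℕ, 2 ≤ n → n ≤ 4 → 2 ≤ d → ∃ A ∈ HermSOS.criticalForms n d,
      (HermSOS.formRank (d + 1) (A * HermSOS.normSq n) : ℝ) = 3 * (n : ℝ) - 4) ∧
    -- (B): the bound for `d = 2`, and its order of magnitude next to that of Ebenfelt's bound
    (∀ n : ℕ, 6 ≤ n → ∀ A ∈ HermSOS.criticalForms n 2,
      ((n : ℝ) ^ 2 + n) / 2 - 6 ≤ (HermSOS.formRank 3 (A * HermSOS.normSq n) : ℝ)) ∧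
    ((fun n : ℕ => ((n : ℝ) ^ 2 + n) / 2 - 6) =Θ[Filter.atTop] fun n : ℕ => (n : ℝ) ^ 2) ∧
    (HermSOS.ebenfeltBound =Θ[Filter.atTop] fun n : ℕ => (n : ℝ) ^ (3 / 2 : ℝ)) ∧
    -- the formulation through real coefficient vectors, and its equivalence with the above
    (∀ n d : ℕ, 2 ≤ n → 2 ≤ d →
      HermSOS.prolongedRanks n d =
        {r | ∃ A ∈ HermSOS.criticalForms n d,
          r = HermSOS.formRank (d + 1) (A * HermSOS.normSq n)} ∧
      (HermSOS.prolongedRanks n d).Nonempty ∧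
      3 * (n : ℝ) - 4 ≤ (HermSOS.minRank n d : ℝ)) ∧
    (∀ n : ℕ, 6 ≤ n → ((n : ℝ) ^ 2 + n) / 2 - 6 ≤ (HermSOS.minRank n 2 : ℝ)) := by

  have hmem : ∀ n d : ℕ, ∀ A ∈ HermSOS.criticalForms n d,
      HermSOS.formRank (d + 1) (A * HermSOS.normSq n) ∈ HermSOS.termCounts n d := by
    intro n d A hA
    rw [← HermSOS.setOf_formRank_eq]
    exact ⟨A, hA, rfl⟩
  have hA : ∀ n d r : ℕ, r ∈ HermSOS.termCounts n d → 3 * (n : ℝ) - 4 ≤ r := by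
    intro n d r hr
    have : ((3 * n : ℕ) : ℝ) ≤ ((r + 4 : ℕ) : ℝ) :=
      Nat.cast_le.2 (HermSOS.three_mul_le_of_mem_termCounts hr)
    push_cast at this
    linarith
  have hB : ∀ n r : ℕ, r ∈ HermSOS.termCounts n 2 → ((n : ℝ) ^ 2 + n) / 2 - 6 ≤ r := by
    intro n r hr
    have : ((n ^ 2 + n : ℕ) : ℝ) ≤ ((2 * r + 4 : ℕ) : ℝ) :=
      Nat.cast_le.2 (HermSOS.sq_add_le_of_mem_termCounts hr)
    push_cast at this
    linarith
  have hmin : ∀ n d : ℕ, 2 ≤ n → 2 ≤ d → HermSOS.minRank n d ∈ HermSOS.termCounts n d := by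
    intro n d hn hd
    rw [HermSOS.minRank, HermSOS.prolongedRanks_eq]
    -- Non-emptiness matters here: `sInf ∅ = 0` in `ℕ` would be no minimum.
    exact Nat.sInf_mem (HermSOS.termCounts_nonempty hn hd)
  refine ⟨fun n d _ _ A hc => hA n d _ (hmem n d A hc), HermSOS.ebenfeltBound_le,
    fun n d hn hn4 hd => ?_, fun n _ A hc => hB n _ (hmem n 2 A hc),
    HermSOS.quadraticBound_isTheta, HermSOS.ebenfeltBound_isTheta, fun n d hn hd => ⟨?_, ?_, ?_⟩,
    fun n hn => hB n _ (hmin n 2 (by omega) le_rfl)⟩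
  · obtain ⟨r, hr, hrn⟩ := HermSOS.exists_mem_termCounts hn hn4 hd
    rw [← HermSOS.setOf_formRank_eq] at hr
    obtain ⟨A, hAc, rfl⟩ := hr
    refine ⟨A, hAc, ?_⟩
    have : ((HermSOS.formRank (d + 1) (A * HermSOS.normSq n) + 4 : ℕ) : ℝ) = ((3 * n : ℕ) : ℝ) :=
      congrArg _ hrn
    push_cast at this
    linarith
  · rw [HermSOS.prolongedRanks_eq, HermSOS.setOf_formRank_eq]
  · rw [HermSOS.prolongedRanks_eq]
    exact HermSOS.termCounts_nonempty hn hd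
  · exact hA n d _ (hmin n d hn hd)
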